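/- Let $\mathcal V$ be a (locally small) monoidal category which is locally presentable and whose tensor product preserves small colimits in each variable. Let $\mathcal V\text{-}\mathbb{M}\mathrm{at}$ be the pseudo double category of $\mathcal V$-matrices: its category of objects is $\mathsf{Set}$; a horizontal 1-cell $S\colon X\nrightarrow Y$ is a family $(S(y,x))_{(y,x)\in Y\times X}$ of objects of $\mathcal V$; a 2-morphism from $S\colon X\nrightarrow Y$ to $T\colon W\nrightarrow Z$ consists of functions $f\colon X\to W$, $g\colon Y\to Z$ and arrows $S(y,x)\to T(g(y),f(x))$; the unit $1_X$ has $1_X(x',x)=I$ if $x=x'$ and $0$ (the initial object) otherwise; and horizontal composition is $(T\odot S)(z,x)=\sum_{y\in Y}T(z,y)\otimes S(y,x)$. Then $\mathcal V\text{-}\mathbb{M}\mathrm{at}$ is a locally presentable double category. That is, writing $\mathbb D$ for it, with category of objects $\mathbb D_0$ and category $\mathbb D_1$ of horizontal 1-cells and 2-morphisms: 1. $\mathbb D$ is fibrant: every vertical 1-cell has a companion and a conjoint; 2. there is a regular cardinal $\lambda$ such that $\mathbb D_0$ and $\mathbb D_1$ are both locally $\lambda$-presentable; 3. the source and target functors $\mathfrak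 s,\mathfrak t\colon\mathbb D_1\to\mathbb D_0$ preserve small colimits and are right adjoints; 4. for every horizontal 1-cell $M\colon X\nrightarrow Y$ the functors $-\odot M\colon{}^{Y}\mathbb D_1\to{}^{X}\mathbb D_1$ and $M\odot-\colon\mathbb D_1^{X}\to\mathbb D_1^{Y}$ are accessible, i.e. for some regular cardinal $\kappa$ (which may depend on the functor) they are functors between $\kappa$-accessible categories that preserve $\kappa$-filtered colimits. Here ${}^{X}\mathbb D_1$ (resp. $\mathbb D_1^{X}$) is the category of horizontal 1-cells with domain (resp. codomain) $X$ and 2-morphisms whose source (resp. target) is $\mathrm{id}_X$. -/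

import Mathlib

open CategoryTheory CategoryTheory.Limits CategoryTheory.MonoidalCategory

universe w v v₀ v₁ u u₀ u₁

/-- A horizontal arrow together with its source and target. For `Hor` the horizontal 1-cells of a
double category these are the objects of the category of arrows `𝔻₁`. -/
structure HArrow {Obj : Type u₀} (Hor : Obj → Obj → Type u₁) where
  src : Obj
  tgt : Obj
  hom : Hor src tgt

/-- A horizontal 1-cell `M : X ⇸ Y` viewed as an object of the category of arrows. -/
abbrev HArrow.of {Obj : Type u₀} {Hor : Obj → Obj → Type u₁} {X Y : Obj} (M : Hor X Y) :
    HArrow Hor :=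
  ⟨X, Y, M⟩

/-- A (pseudo) double category. The category of objects `𝔻₀` is `Obj`, the category of arrows `𝔻₁`
is `HArrow Hor`; the source and target functors are the projections on objects and
`srcMap`, `tgtMap` on morphisms. An object of `𝔻₁ ×_{𝔻₀} 𝔻₁` is a pair of composable horizontal
1-cells `M : Y ⇸ Z`, `N : X ⇸ Y`, and a morphism of it is a pair `α`, `β` of 2-morphisms
with `srcMap α = tgtMap β`. -/
structure PseudoDoubleCategory where
  Obj : Type u₀
  [catObj : Category.{v₀} Obj]
  Hor : Obj → Obj → Type u₁
  [catArr : Category.{v₁} (HArrow Hor)]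
  srcMap {M N : HArrow Hor} (α : M ⟶ N) : M.src ⟶ N.src
  tgtMap {M N : HArrow Hor} (α : M ⟶ N) : M.tgt ⟶ N.tgt
  srcMap_id (M : HArrow Hor) : srcMap (𝟙 M) = 𝟙 M.src
  tgtMap_id (M : HArrow Hor) : tgtMap (𝟙 M) = 𝟙 M.tgt
  srcMap_comp {M N P : HArrow Hor} (α : M ⟶ N) (β : N ⟶ P) :
    srcMap (α ≫ β) = srcMap α ≫ srcMap β
  tgtMap_comp {M N P : HArrow Hor} (α : M ⟶ N) (β : N ⟶ P) :
    tgtMap (α ≫ β) = tgtMap α ≫ tgtMap β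
  /-- The horizontal unit `1_X`. -/
  unit (X : Obj) : Hor X X
  unitMap {X Y : Obj} (f : X ⟶ Y) : HArrow.of (unit X) ⟶ HArrow.of (unit Y)
  srcMap_unitMap {X Y : Obj} (f : X ⟶ Y) : srcMap (unitMap f) = f
  tgtMap_unitMap {X Y : Obj} (f : X ⟶ Y) : tgtMap (unitMap f) = f
  unitMap_id (X : Obj) : unitMap (𝟙 X) = 𝟙 (HArrow.of (unit X))
  unitMap_comp {X Y Z : Obj} (f : X ⟶ Y) (g : Y ⟶ Z) :
    unitMap (f ≫ g) = unitMap f ≫ unitMap g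
  /-- Horizontal composition `M ⊙ N` (first `N`, then `M`). -/
  comp {X Y Z : Obj} (M : Hor Y Z) (N : Hor X Y) : Hor X Z
  compMap {X Y Z X' Y' Z' : Obj} {M : Hor Y Z} {N : Hor X Y} {M' : Hor Y' Z'} {N' : Hor X' Y'}
    (α : HArrow.of M ⟶ HArrow.of M') (β : HArrow.of N ⟶ HArrow.of N')
    (h : srcMap α = tgtMap β) : HArrow.of (comp M N) ⟶ HArrow.of (comp M' N')
  srcMap_compMap {X Y Z X' Y' Z' : Obj} {M : Hor Y Z} {N : Hor X Y} {M' : Hor Y' Z'}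
    {N' : Hor X' Y'} (α : HArrow.of M ⟶ HArrow.of M') (β : HArrow.of N ⟶ HArrow.of N')
    (h : srcMap α = tgtMap β) : srcMap (compMap α β h) = srcMap β
  tgtMap_compMap {X Y Z X' Y' Z' : Obj} {M : Hor Y Z} {N : Hor X Y} {M' : Hor Y' Z'}
    {N' : Hor X' Y'} (α : HArrow.of M ⟶ HArrow.of M') (β : HArrow.of N ⟶ HArrow.of N')
    (h : srcMap α = tgtMap β) : tgtMap (compMap α β h) = tgtMap α
  compMap_id {X Y Z : Obj} (M : Hor Y Z) (N : Hor X Y) :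
    compMap (𝟙 (HArrow.of M)) (𝟙 (HArrow.of N)) ((srcMap_id (HArrow.of M)).trans (tgtMap_id (HArrow.of N)).symm) =
      𝟙 (HArrow.of (comp M N))
  compMap_comp {X Y Z X' Y' Z' X'' Y'' Z'' : Obj} {M : Hor Y Z} {N : Hor X Y}
    {M' : Hor Y' Z'} {N' : Hor X' Y'} {M'' : Hor Y'' Z''} {N'' : Hor X'' Y''}
    (α : HArrow.of M ⟶ HArrow.of M') (β : HArrow.of N ⟶ HArrow.of N')
    (α' : HArrow.of M' ⟶ HArrow.of M'') (β' : HArrow.of N' ⟶ HArrow.of N'')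
    (h : srcMap α = tgtMap β) (h' : srcMap α' = tgtMap β') :
    compMap (α ≫ α') (β ≫ β') (by rw [srcMap_comp, tgtMap_comp, h, h']) =
      compMap α β h ≫ compMap α' β' h'
  /-- The associator `(M ⊙ N) ⊙ P ≅ M ⊙ (N ⊙ P)`. -/
  assoc {W X Y Z : Obj} (M : Hor Y Z) (N : Hor X Y) (P : Hor W X) :
    HArrow.of (comp (comp M N) P) ≅ HArrow.of (comp M (comp N P))
  srcMap_assoc {W X Y Z : Obj} (M : Hor Y Z) (N : Hor X Y) (P : Hor W X) :
    srcMap (assoc M N P).hom = 𝟙 W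
  tgtMap_assoc {W X Y Z : Obj} (M : Hor Y Z) (N : Hor X Y) (P : Hor W X) :
    tgtMap (assoc M N P).hom = 𝟙 Z
  assoc_naturality {W X Y Z W' X' Y' Z' : Obj} {M : Hor Y Z} {N : Hor X Y} {P : Hor W X}
    {M' : Hor Y' Z'} {N' : Hor X' Y'} {P' : Hor W' X'}
    (α : HArrow.of M ⟶ HArrow.of M') (β : HArrow.of N ⟶ HArrow.of N')
    (γ : HArrow.of P ⟶ HArrow.of P') (h : srcMap α = tgtMap β) (h' : srcMap β = tgtMap γ) :
    compMap (compMap α β h) γ ((srcMap_compMap α β h).trans h') ≫ (assoc M' N' P').hom =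
      (assoc M N P).hom ≫ compMap α (compMap β γ h') (h.trans (tgtMap_compMap β γ h').symm)
  /-- The left unitor `1_Y ⊙ M ≅ M`. -/
  leftUnitor {X Y : Obj} (M : Hor X Y) : HArrow.of (comp (unit Y) M) ≅ HArrow.of M
  srcMap_leftUnitor {X Y : Obj} (M : Hor X Y) : srcMap (leftUnitor M).hom = 𝟙 X
  tgtMap_leftUnitor {X Y : Obj} (M : Hor X Y) : tgtMap (leftUnitor M).hom = 𝟙 Y
  leftUnitor_naturality {X Y X' Y' : Obj} {M : Hor X Y} {M' : Hor X' Y'}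
    (α : HArrow.of M ⟶ HArrow.of M') :
    compMap (unitMap (tgtMap α)) α (srcMap_unitMap _) ≫ (leftUnitor M').hom =
      (leftUnitor M).hom ≫ α
  /-- The right unitor `M ⊙ 1_X ≅ M`. -/
  rightUnitor {X Y : Obj} (M : Hor X Y) : HArrow.of (comp M (unit X)) ≅ HArrow.of M
  srcMap_rightUnitor {X Y : Obj} (M : Hor X Y) : srcMap (rightUnitor M).hom = 𝟙 X
  tgtMap_rightUnitor {X Y : Obj} (M : Hor X Y) : tgtMap (rightUnitor M).hom = 𝟙 Y
  rightUnitor_naturality {X Y X' Y' : Obj} {M : Hor X Y} {M' : Hor X' Y'}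
    (α : HArrow.of M ⟶ HArrow.of M') :
    compMap α (unitMap (srcMap α)) (tgtMap_unitMap _).symm ≫ (rightUnitor M').hom =
      (rightUnitor M).hom ≫ α
  pentagon {V W X Y Z : Obj} (M : Hor Y Z) (N : Hor X Y) (P : Hor W X) (Q : Hor V W) :
    compMap (assoc M N P).hom (𝟙 (HArrow.of Q))
        ((srcMap_assoc M N P).trans (tgtMap_id (HArrow.of Q)).symm) ≫
      (assoc M (comp N P) Q).hom ≫
        compMap (𝟙 (HArrow.of M)) (assoc N P Q).hom
          ((srcMap_id (HArrow.of M)).trans (tgtMap_assoc N P Q).symm) =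
      (assoc (comp M N) P Q).hom ≫ (assoc M N (comp P Q)).hom
  triangle {X Y Z : Obj} (M : Hor Y Z) (N : Hor X Y) :
    (assoc M (unit Y) N).hom ≫
      compMap (𝟙 (HArrow.of M)) (leftUnitor N).hom
        ((srcMap_id (HArrow.of M)).trans (tgtMap_leftUnitor N).symm) =
      compMap (rightUnitor M).hom (𝟙 (HArrow.of N))
        ((srcMap_rightUnitor M).trans (tgtMap_id (HArrow.of N)).symm)

namespace PseudoDoubleCategory

attribute [instance] catObj catArr

variable (D : PseudoDoubleCategory.{v₀, v₁, u₀, u₁})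

/-- The category of arrows `𝔻₁`. -/
abbrev Arr : Type (max u₀ u₁) := HArrow D.Hor

/-- The source functor `𝔰 : 𝔻₁ ⥤ 𝔻₀`. -/
def src : D.Arr ⥤ D.Obj where
  obj M := M.src
  map α := D.srcMap α
  map_id := D.srcMap_id
  map_comp := D.srcMap_comp

/-- The target functor `𝔱 : 𝔻₁ ⥤ 𝔻₀`. -/
def tgt : D.Arr ⥤ D.Obj where
  obj M := M.tgt
  map α := D.tgtMap α
  map_id := D.tgtMap_id
  map_comp := D.tgtMap_comp

/-- A companion of a vertical 1-cell `f : X ⟶ Y`. -/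
structure Companion {X Y : D.Obj} (f : X ⟶ Y) where
  hor : D.Hor X Y
  p₁ : HArrow.of hor ⟶ HArrow.of (D.unit Y)
  p₂ : HArrow.of (D.unit X) ⟶ HArrow.of hor
  srcMap_p₁ : D.srcMap p₁ = f
  tgtMap_p₁ : D.tgtMap p₁ = 𝟙 Y
  srcMap_p₂ : D.srcMap p₂ = 𝟙 X
  tgtMap_p₂ : D.tgtMap p₂ = f
  p₂_comp_p₁ : p₂ ≫ p₁ = D.unitMap f
  p₁_hcomp_p₂ : D.compMap p₁ p₂ (srcMap_p₁.trans tgtMap_p₂.symm) ≫ (D.leftUnitor hor).hom =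
    (D.rightUnitor hor).hom

/-- A conjoint of a vertical 1-cell `f : X ⟶ Y`. -/
structure Conjoint {X Y : D.Obj} (f : X ⟶ Y) where
  hor : D.Hor Y X
  q₁ : HArrow.of hor ⟶ HArrow.of (D.unit Y)
  q₂ : HArrow.of (D.unit X) ⟶ HArrow.of hor
  srcMap_q₁ : D.srcMap q₁ = 𝟙 Y
  tgtMap_q₁ : D.tgtMap q₁ = f
  srcMap_q₂ : D.srcMap q₂ = f
  tgtMap_q₂ : D.tgtMap q₂ = 𝟙 X
  q₂_comp_q₁ : q₂ ≫ q₁ = D.unitMap f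
  q₂_hcomp_q₁ : D.compMap q₂ q₁ (srcMap_q₂.trans tgtMap_q₁.symm) ≫ (D.rightUnitor hor).hom =
    (D.leftUnitor hor).hom

/-- A double category is fibrant if every vertical 1-cell has a companion and a conjoint. -/
def IsFibrant : Prop :=
  ∀ ⦃X Y : D.Obj⦄ (f : X ⟶ Y), Nonempty (D.Companion f) ∧ Nonempty (D.Conjoint f)

/-- The objects of the fixed-domain category `ˣ𝔻₁`. -/
structure FixedSrc (X : D.Obj) where
  tgt : D.Obj
  hor : D.Hor X tgt

/-- The objects of the fixed-codomain category `𝔻₁ʸ`. -/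
structure FixedTgt (Y : D.Obj) where
  src : D.Obj
  hor : D.Hor src Y

/-- The morphisms of `ˣ𝔻₁` are the 2-morphisms whose source is the identity. -/
instance (X : D.Obj) : Category (D.FixedSrc X) where
  Hom M N := { α : HArrow.of M.hor ⟶ HArrow.of N.hor // D.srcMap α = 𝟙 X }
  id M := ⟨𝟙 _, D.srcMap_id _⟩
  comp α β := ⟨α.1 ≫ β.1, by rw [D.srcMap_comp, α.2, β.2, Category.comp_id]⟩
  id_comp α := Subtype.ext (Category.id_comp α.1)
  comp_id α := Subtype.ext (Category.comp_id α.1)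
  assoc α β γ := Subtype.ext (Category.assoc α.1 β.1 γ.1)

/-- The morphisms of `𝔻₁ʸ` are the 2-morphisms whose target is the identity. -/
instance (Y : D.Obj) : Category (D.FixedTgt Y) where
  Hom M N := { α : HArrow.of M.hor ⟶ HArrow.of N.hor // D.tgtMap α = 𝟙 Y }
  id M := ⟨𝟙 _, D.tgtMap_id _⟩
  comp α β := ⟨α.1 ≫ β.1, by rw [D.tgtMap_comp, α.2, β.2, Category.comp_id]⟩
  id_comp α := Subtype.ext (Category.id_comp α.1)
  comp_id α := Subtype.ext (Category.comp_id α.1)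
  assoc α β γ := Subtype.ext (Category.assoc α.1 β.1 γ.1)

/-- The functor `- ⊙ M : ʸ𝔻₁ ⥤ ˣ𝔻₁` for `M : X ⇸ Y`. -/
def precomp {X Y : D.Obj} (M : D.Hor X Y) : D.FixedSrc Y ⥤ D.FixedSrc X where
  obj N := ⟨N.tgt, D.comp N.hor M⟩
  map α := ⟨D.compMap α.1 (𝟙 (HArrow.of M)) (α.2.trans (D.tgtMap_id (HArrow.of M)).symm),
    (D.srcMap_compMap _ _ _).trans (D.srcMap_id _)⟩
  map_id N := Subtype.ext (D.compMap_id N.hor M)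
  map_comp α β := Subtype.ext (by
    have h := D.compMap_comp α.1 (𝟙 (HArrow.of M)) β.1 (𝟙 (HArrow.of M))
      (α.2.trans (D.tgtMap_id (HArrow.of M)).symm) (β.2.trans (D.tgtMap_id (HArrow.of M)).symm)
    simp only [Category.comp_id] at h
    exact h)

/-- The functor `M ⊙ - : 𝔻₁ˣ ⥤ 𝔻₁ʸ` for `M : X ⇸ Y`. -/
def postcomp {X Y : D.Obj} (M : D.Hor X Y) : D.FixedTgt X ⥤ D.FixedTgt Y where
  obj N := ⟨N.src, D.comp M N.hor⟩
  map α := ⟨D.compMap (𝟙 (HArrow.of M)) α.1 ((D.srcMap_id (HArrow.of M)).trans α.2.symm),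
    (D.tgtMap_compMap _ _ _).trans (D.tgtMap_id _)⟩
  map_id N := Subtype.ext (D.compMap_id M N.hor)
  map_comp α β := Subtype.ext (by
    have h := D.compMap_comp (𝟙 (HArrow.of M)) α.1 (𝟙 (HArrow.of M)) β.1
      ((D.srcMap_id (HArrow.of M)).trans α.2.symm) ((D.srcMap_id (HArrow.of M)).trans β.2.symm)
    simp only [Category.comp_id] at h
    exact h)

end PseudoDoubleCategory

/-- A functor is accessible (relative to the universe `w` of small sets) if for some regular
cardinal `κ` its domain and codomain are `κ`-accessible categories and it preserves `κ`-filtered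
colimits. -/
def IsAccessibleFunctor {C : Type u₀} [Category.{v₀} C] {E : Type u₁} [Category.{v₁} E]
    (F : C ⥤ E) : Prop :=
  ∃ (κ : Cardinal.{w}) (_ : Fact κ.IsRegular), IsCardinalAccessibleCategory C κ ∧
    IsCardinalAccessibleCategory E κ ∧ F.IsCardinalAccessible κ

/-- A double category is locally `κ`-presentable if it is fibrant, `𝔻₀` and `𝔻₁` are locally
`κ`-presentable, `𝔰` and `𝔱` are cocontinuous right adjoints, and `- ⊙ M`, `M ⊙ -` are accessible
for every horizontal 1-cell `M`. -/
structure PseudoDoubleCategory.IsCardinalLocallyPresentable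
    (D : PseudoDoubleCategory.{v₀, v₁, u₀, u₁}) (κ : Cardinal.{w}) [Fact κ.IsRegular] :
    Prop where
  fibrant : D.IsFibrant
  obj : CategoryTheory.IsCardinalLocallyPresentable D.Obj κ
  arr : CategoryTheory.IsCardinalLocallyPresentable D.Arr κ
  src_cocontinuous : PreservesColimitsOfSize.{w, w} D.src
  src_isRightAdjoint : D.src.IsRightAdjoint
  tgt_cocontinuous : PreservesColimitsOfSize.{w, w} D.tgt
  tgt_isRightAdjoint : D.tgt.IsRightAdjoint
  precomp_accessible {X Y : D.Obj} (M : D.Hor X Y) : IsAccessibleFunctor.{w} (D.precomp M)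
  postcomp_accessible {X Y : D.Obj} (M : D.Hor X Y) : IsAccessibleFunctor.{w} (D.postcomp M)

/-- A double category is locally presentable if it is locally `κ`-presentable for some regular
cardinal `κ` (in the universe `w` of small sets). -/
def PseudoDoubleCategory.IsLocallyPresentable (D : PseudoDoubleCategory.{v₀, v₁, u₀, u₁}) : Prop :=
  ∃ (κ : Cardinal.{w}) (_ : Fact κ.IsRegular), D.IsCardinalLocallyPresentable κ

instance hasColimitsOfSize_of_isLocallyPresentable (C : Type u) [Category.{v} C]
    [IsLocallyPresentable.{w} C] : HasColimitsOfSize.{w, w} C := by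
  obtain ⟨κ, _, _⟩ := IsLocallyPresentable.exists_cardinal.{w} C
  infer_instance

noncomputable section

namespace VMat

/-- A `V`-matrix `X ⇸ Y`: a family of objects `S y x` of `V`, for `y : Y` and `x : X`. -/
abbrev Mat (V : Type u) (X Y : Type w) : Type (max u w) := Y → X → V

section Cells

variable {V : Type u} [Category.{w} V]

/-- A 2-morphism of `V`-matrices: functions `left` and `right` and a family of arrows
`S y x ⟶ T (right y) (left x)`. -/
structure Cell (S T : HArrow (Mat.{w} V)) where
  left : S.src ⟶ T.src
  right : S.tgt ⟶ T.tgt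
  app (y : S.tgt) (x : S.src) : S.hom y x ⟶ T.hom (right y) (left x)

theorem Cell.mk_ext {S T : HArrow (Mat.{w} V)} {l : S.src ⟶ T.src} {r : S.tgt ⟶ T.tgt}
    {a b : ∀ (y : S.tgt) (x : S.src), S.hom y x ⟶ T.hom (r y) (l x)}
    (h : ∀ y x, a y x = b y x) : Cell.mk l r a = Cell.mk l r b := by
  congr
  funext y x
  exact h y x

instance matCategory : Category.{w} (HArrow (Mat.{w} V)) where
  Hom := Cell
  id S := ⟨𝟙 _, 𝟙 _, fun y x => 𝟙 (S.hom y x)⟩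
  comp α β := ⟨α.left ≫ β.left, α.right ≫ β.right,
    fun y x => α.app y x ≫ β.app (α.right y) (α.left x)⟩
  id_comp _ := Cell.mk_ext fun _ _ => Category.id_comp _
  comp_id _ := Cell.mk_ext fun _ _ => Category.comp_id _
  assoc _ _ _ := Cell.mk_ext fun _ _ => Category.assoc _ _ _

/-- A family of isomorphisms gives a globular isomorphism of matrices. -/
def globularIso {X Y : Type w} {S T : Mat V X Y} (e : ∀ y x, S y x ≅ T y x) :
    (⟨X, Y, S⟩ : HArrow (Mat.{w} V)) ≅ ⟨X, Y, T⟩ where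
  hom := ⟨𝟙 X, 𝟙 Y, fun y x => (e y x).hom⟩
  inv := ⟨𝟙 X, 𝟙 Y, fun y x => (e y x).inv⟩
  hom_inv_id := Cell.mk_ext fun y x => (e y x).hom_inv_id
  inv_hom_id := Cell.mk_ext fun y x => (e y x).inv_hom_id

end Cells

section Distrib

theorem hasInitial_of_hasCoproducts {V : Type u} [Category.{w} V] [HasCoproducts.{w} V] :
    HasInitial V :=
  hasColimitsOfShape_of_equivalence
    (Discrete.equivalence (Equiv.equivPEmpty (α := PEmpty.{w + 1})) :
      Discrete PEmpty.{w + 1} ≌ Discrete PEmpty.{1})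

attribute [local instance] hasInitial_of_hasCoproducts

theorem preservesEmpty {V : Type u} [Category.{w} V] {F : V ⥤ V}
    (h : ∀ J : Type w, PreservesColimitsOfShape (Discrete J) F) :
    PreservesColimitsOfShape (Discrete PEmpty.{1}) F :=
  have := h PEmpty.{w + 1}
  preservesColimitsOfShape_of_equiv
    (Discrete.equivalence (Equiv.equivPEmpty (α := PEmpty.{w + 1})) :
      Discrete PEmpty.{w + 1} ≌ Discrete PEmpty.{1}) F

variable {V : Type u} [Category.{w} V] [MonoidalCategory V] [HasCoproducts.{w} V]

section Right

variable [∀ (A : V) (J : Type w), PreservesColimitsOfShape (Discrete J) (tensorRight A)]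

/-- A morphism out of `(∐ A) ⊗ B` from its components. -/
def descR {J : Type w} {A : J → V} {B T : V} (f : ∀ j, A j ⊗ B ⟶ T) : (∐ A) ⊗ B ⟶ T :=
  inv (sigmaComparison (tensorRight B) A) ≫ Sigma.desc f

theorem ι_descR {J : Type w} {A : J → V} {B T : V} (f : ∀ j, A j ⊗ B ⟶ T) (j : J) :
    Sigma.ι A j ▷ B ≫ descR f = f j := by
  have h : Sigma.ι A j ▷ B ≫ inv (sigmaComparison (tensorRight B) A) =
      Sigma.ι (fun j => A j ⊗ B) j := by
    rw [IsIso.comp_inv_eq]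
    exact (ι_comp_sigmaComparison (tensorRight B) A j).symm
  rw [descR, reassoc_of% h, Sigma.ι_desc]

theorem hom_extR {J : Type w} {A : J → V} {B T : V} {f g : (∐ A) ⊗ B ⟶ T}
    (h : ∀ j, Sigma.ι A j ▷ B ≫ f = Sigma.ι A j ▷ B ≫ g) : f = g := by
  rw [← cancel_epi (sigmaComparison (tensorRight B) A)]
  refine Sigma.hom_ext _ _ fun j => ?_
  have e := ι_comp_sigmaComparison (tensorRight B) A j
  rw [reassoc_of% e, reassoc_of% e]
  exact h j

end Right

section Left

variable [∀ (A : V) (J : Type w), PreservesColimitsOfShape (Discrete J) (tensorLeft A)]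

/-- A morphism out of `B ⊗ (∐ A)` from its components. -/
def descL {J : Type w} {A : J → V} {B T : V} (f : ∀ j, B ⊗ A j ⟶ T) : B ⊗ (∐ A) ⟶ T :=
  inv (sigmaComparison (tensorLeft B) A) ≫ Sigma.desc f

theorem ι_descL {J : Type w} {A : J → V} {B T : V} (f : ∀ j, B ⊗ A j ⟶ T) (j : J) :
    B ◁ Sigma.ι A j ≫ descL f = f j := by
  have h : B ◁ Sigma.ι A j ≫ inv (sigmaComparison (tensorLeft B) A) =
      Sigma.ι (fun j => B ⊗ A j) j := by
    rw [IsIso.comp_inv_eq]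
    exact (ι_comp_sigmaComparison (tensorLeft B) A j).symm
  rw [descL, reassoc_of% h, Sigma.ι_desc]

theorem hom_extL {J : Type w} {A : J → V} {B T : V} {f g : B ⊗ (∐ A) ⟶ T}
    (h : ∀ j, B ◁ Sigma.ι A j ≫ f = B ◁ Sigma.ι A j ≫ g) : f = g := by
  rw [← cancel_epi (sigmaComparison (tensorLeft B) A)]
  refine Sigma.hom_ext _ _ fun j => ?_
  have e := ι_comp_sigmaComparison (tensorLeft B) A j
  rw [reassoc_of% e, reassoc_of% e]
  exact h j

end Left

open Classical in
variable (V) in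
/-- The object `I` if `p` holds, and `0` otherwise. -/
def unitObj (p : Prop) : V := if p then 𝟙_ V else ⊥_ V

def unitIso {p : Prop} (h : p) : 𝟙_ V ≅ unitObj V p := eqToIso (if_pos h).symm

def unitι {p : Prop} (h : p) : 𝟙_ V ⟶ unitObj V p := (unitIso h).hom

instance {p : Prop} (h : p) : IsIso (unitι (V := V) h) := inferInstanceAs (IsIso (unitIso h).hom)

def isInitialUnitObj {p : Prop} (h : ¬ p) : IsInitial (unitObj V p) :=
  initialIsInitial.ofIso (eqToIso (if_neg h).symm)

open Classical in
def unitDesc {p : Prop} {T : V} (f : p → (𝟙_ V ⟶ T)) : unitObj V p ⟶ T :=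
  if h : p then (unitIso h).inv ≫ f h else (isInitialUnitObj h).to T

theorem unitι_desc {p : Prop} {T : V} (f : p → (𝟙_ V ⟶ T)) (h : p) :
    unitι h ≫ unitDesc f = f h := by
  simp [unitι, unitDesc, h]

theorem unit_hom_ext {p : Prop} {T : V} {f g : unitObj V p ⟶ T}
    (h : ∀ hp : p, unitι hp ≫ f = unitι hp ≫ g) : f = g := by
  by_cases hp : p
  · exact (cancel_epi _).1 (h hp)
  · exact (isInitialUnitObj hp).hom_ext f g

section Right

variable [∀ (A : V) (J : Type w), PreservesColimitsOfShape (Discrete J) (tensorRight A)]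

def isInitialUnitObjTensor {p : Prop} (B : V) (h : ¬ p) : IsInitial (unitObj V p ⊗ B) :=
  have := preservesEmpty (F := tensorRight B) inferInstance
  IsInitial.isInitialObj (tensorRight B) _ (isInitialUnitObj h)

open Classical in
def unitDescR {p : Prop} {B T : V} (f : p → (B ⟶ T)) : unitObj V p ⊗ B ⟶ T :=
  if h : p then (unitIso h).inv ▷ B ≫ (λ_ B).hom ≫ f h else (isInitialUnitObjTensor B h).to T

theorem unitι_descR {p : Prop} {B T : V} (f : p → (B ⟶ T)) (h : p) :
    unitι h ▷ B ≫ unitDescR f = (λ_ B).hom ≫ f h := by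
  simp [unitι, unitDescR, h]

theorem unit_hom_extR {p : Prop} {B T : V} {f g : unitObj V p ⊗ B ⟶ T}
    (h : ∀ hp : p, unitι hp ▷ B ≫ f = unitι hp ▷ B ≫ g) : f = g := by
  by_cases hp : p
  · exact (cancel_epi _).1 (h hp)
  · exact (isInitialUnitObjTensor B hp).hom_ext f g

end Right

section Left

variable [∀ (A : V) (J : Type w), PreservesColimitsOfShape (Discrete J) (tensorLeft A)]

def isInitialTensorUnitObj {p : Prop} (B : V) (h : ¬ p) : IsInitial (B ⊗ unitObj V p) :=
  have := preservesEmpty (F := tensorLeft B) inferInstance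
  IsInitial.isInitialObj (tensorLeft B) _ (isInitialUnitObj h)

open Classical in
def unitDescL {p : Prop} {B T : V} (f : p → (B ⟶ T)) : B ⊗ unitObj V p ⟶ T :=
  if h : p then B ◁ (unitIso h).inv ≫ (ρ_ B).hom ≫ f h else (isInitialTensorUnitObj B h).to T

theorem unitι_descL {p : Prop} {B T : V} (f : p → (B ⟶ T)) (h : p) :
    B ◁ unitι h ≫ unitDescL f = (ρ_ B).hom ≫ f h := by
  simp [unitι, unitDescL, h]

theorem unit_hom_extL {p : Prop} {B T : V} {f g : B ⊗ unitObj V p ⟶ T}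
    (h : ∀ hp : p, B ◁ unitι hp ≫ f = B ◁ unitι hp ≫ g) : f = g := by
  by_cases hp : p
  · exact (cancel_epi _).1 (h hp)
  · exact (isInitialTensorUnitObj B hp).hom_ext f g

end Left

end Distrib

section Double

set_option linter.unusedSectionVars false

variable {V : Type u} [Category.{w} V] [MonoidalCategory V] [HasCoproducts.{w} V]

/-- The identity matrix: `1_X x' x` is `I` if `x = x'`, and `0` otherwise. -/
def unit (X : Type w) : Mat V X X := fun x' x => unitObj V (x = x')

/-- The canonical map `I ⟶ 1_X x x`. -/
def idι {X : Type w} (x : X) : 𝟙_ V ⟶ unit X x x := unitι (V := V) (p := x = x) rfl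

/-- The matrix map `1_X ⟶ 1_Y` over a function `f`. -/
def unitApp {X Y : Type w} (f : X → Y) (x' x : X) : unit (V := V) X x' x ⟶ unit Y (f x') (f x) :=
  unitDesc (p := x = x') fun h => unitι (p := f x = f x') (congrArg f h)

theorem idι_unitApp {X Y : Type w} (f : X → Y) (x : X) :
    idι (V := V) x ≫ unitApp f x x = idι (f x) :=
  unitι_desc (V := V) _ _

theorem idι_unitApp_comp {X Y Z : Type w} (f : X → Y) (g : Y → Z) (x : X) :
    idι (V := V) x ≫ unitApp f x x ≫ unitApp g (f x) (f x) = idι (g (f x)) := by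
  rw [← Category.assoc, idι_unitApp, idι_unitApp]

theorem unitMat_ext {X : Type w} {T : X → X → V} {f g : ∀ x' x, unit (V := V) X x' x ⟶ T x' x}
    (h : ∀ x, idι x ≫ f x x = idι x ≫ g x x) (x' x : X) : f x' x = g x' x :=
  unit_hom_ext (p := x = x') fun e => by
    subst e
    exact h x

/-- The composite matrix: `(M ⊙ N) z x = ∑ y, M z y ⊗ N y x`. -/
def comp {X Y Z : Type w} (M : Mat V Y Z) (N : Mat V X Y) : Mat V X Z :=
  fun z x => ∐ fun y => M z y ⊗ N y x

/-- The inclusion of a summand of the composite matrix. -/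
def compι {X Y Z : Type w} (M : Mat V Y Z) (N : Mat V X Y) (z : Z) (y : Y) (x : X) :
    M z y ⊗ N y x ⟶ comp M N z x :=
  Sigma.ι (fun y => M z y ⊗ N y x) y

section Comp

variable {X Y Z : Type w} {M : Mat V Y Z} {N : Mat V X Y} {z : Z} {x : X} {B T T' : V}

def compDesc (f : ∀ y, M z y ⊗ N y x ⟶ T) : comp M N z x ⟶ T := Sigma.desc f

theorem compι_desc (f : ∀ y, M z y ⊗ N y x ⟶ T) (y : Y) :
    compι M N z y x ≫ compDesc f = f y :=
  Sigma.ι_desc _ _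

theorem comp_hom_ext {f g : comp M N z x ⟶ T}
    (h : ∀ y, compι M N z y x ≫ f = compι M N z y x ≫ g) : f = g :=
  Sigma.hom_ext _ _ h

def compDescR [∀ (A : V) (J : Type w), PreservesColimitsOfShape (Discrete J) (tensorRight A)]
    (f : ∀ y, (M z y ⊗ N y x) ⊗ B ⟶ T) : comp M N z x ⊗ B ⟶ T :=
  descR f

theorem compι_descR [∀ (A : V) (J : Type w), PreservesColimitsOfShape (Discrete J) (tensorRight A)]
    (f : ∀ y, (M z y ⊗ N y x) ⊗ B ⟶ T) (y : Y) :
    compι M N z y x ▷ B ≫ compDescR f = f y :=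
  ι_descR f y

theorem comp_hom_extR [∀ (A : V) (J : Type w), PreservesColimitsOfShape (Discrete J) (tensorRight A)]
    {f g : comp M N z x ⊗ B ⟶ T}
    (h : ∀ y, compι M N z y x ▷ B ≫ f = compι M N z y x ▷ B ≫ g) : f = g :=
  hom_extR h

def compDescL [∀ (A : V) (J : Type w), PreservesColimitsOfShape (Discrete J) (tensorLeft A)]
    (f : ∀ y, B ⊗ (M z y ⊗ N y x) ⟶ T) : B ⊗ comp M N z x ⟶ T :=
  descL f

theorem compι_descL [∀ (A : V) (J : Type w), PreservesColimitsOfShape (Discrete J) (tensorLeft A)]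
    (f : ∀ y, B ⊗ (M z y ⊗ N y x) ⟶ T) (y : Y) :
    B ◁ compι M N z y x ≫ compDescL f = f y :=
  ι_descL f y

theorem comp_hom_extL [∀ (A : V) (J : Type w), PreservesColimitsOfShape (Discrete J) (tensorLeft A)]
    {f g : B ⊗ comp M N z x ⟶ T}
    (h : ∀ y, B ◁ compι M N z y x ≫ f = B ◁ compι M N z y x ≫ g) : f = g :=
  hom_extL h

end Comp

section CompApp

variable {X Y Z X' Y' Z' X'' Y'' Z'' : Type w} {M : Mat V Y Z} {N : Mat V X Y} {M' : Mat V Y' Z'}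
  {N' : Mat V X' Y'} {M'' : Mat V Y'' Z''} {N'' : Mat V X'' Y''}

/-- Horizontal composition of 2-morphisms, given by
`M z y ⊗ N y x ⟶ M' (g z) (f y) ⊗ N' (f y) (e x)` on summands. -/
def compApp {g : Z → Z'} {f : Y → Y'} {e : X → X'} (a : ∀ z y, M z y ⟶ M' (g z) (f y))
    (b : ∀ y x, N y x ⟶ N' (f y) (e x)) (z : Z) (x : X) :
    comp M N z x ⟶ comp M' N' (g z) (e x) :=
  compDesc fun y => (a z y ⊗ₘ b y x) ≫ compι M' N' (g z) (f y) (e x)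

theorem ι_compApp {g : Z → Z'} {f : Y → Y'} {e : X → X'} (a : ∀ z y, M z y ⟶ M' (g z) (f y))
    (b : ∀ y x, N y x ⟶ N' (f y) (e x)) (z : Z) (y : Y) (x : X) :
    compι M N z y x ≫ compApp a b z x = (a z y ⊗ₘ b y x) ≫ compι M' N' (g z) (f y) (e x) :=
  compι_desc _ _

theorem ι_compApp_assoc {g : Z → Z'} {f : Y → Y'} {e : X → X'}
    (a : ∀ z y, M z y ⟶ M' (g z) (f y)) (b : ∀ y x, N y x ⟶ N' (f y) (e x)) (z : Z) (y : Y)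
    (x : X) {T : V} (t : comp M' N' (g z) (e x) ⟶ T) :
    compι M N z y x ≫ compApp a b z x ≫ t =
      (a z y ⊗ₘ b y x) ≫ compι M' N' (g z) (f y) (e x) ≫ t := by
  rw [← Category.assoc, ι_compApp, Category.assoc]

theorem compApp_id (z : Z) (x : X) :
    compApp (M := M) (N := N) (g := fun z => z) (f := fun y => y) (e := fun x => x)
      (fun _ _ => 𝟙 _) (fun _ _ => 𝟙 _) z x = 𝟙 _ :=
  comp_hom_ext fun y => by
    rw [ι_compApp]
    simp

theorem compApp_comp {g : Z → Z'} {f : Y → Y'} {e : X → X'} (a : ∀ z y, M z y ⟶ M' (g z) (f y))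
    (b : ∀ y x, N y x ⟶ N' (f y) (e x)) {g' : Z' → Z''} {f' : Y' → Y''} {e' : X' → X''}
    (a' : ∀ z y, M' z y ⟶ M'' (g' z) (f' y)) (b' : ∀ y x, N' y x ⟶ N'' (f' y) (e' x))
    (z : Z) (x : X) :
    compApp (g := fun z => g' (g z)) (f := fun y => f' (f y)) (e := fun x => e' (e x))
      (fun z y => a z y ≫ a' (g z) (f y)) (fun y x => b y x ≫ b' (f y) (e x)) z x =
      compApp a b z x ≫ compApp a' b' (g z) (e x) :=
  comp_hom_ext fun y => by
    rw [ι_compApp, ι_compApp_assoc, ι_compApp]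
    simp

/-- Horizontal composition of 2-morphisms with matching middle function. -/
def compMap (α : (⟨Y, Z, M⟩ : HArrow (Mat.{w} V)) ⟶ ⟨Y', Z', M'⟩)
    (β : (⟨X, Y, N⟩ : HArrow (Mat.{w} V)) ⟶ ⟨X', Y', N'⟩)
    (h : Cell.left α = Cell.right β) :
    (⟨X, Z, comp M N⟩ : HArrow (Mat.{w} V)) ⟶ ⟨X', Z', comp M' N'⟩ :=
  Cell.mk β.left α.right
    (compApp (g := α.right) (f := α.left) (e := β.left) α.app
      (fun y x => β.app y x ≫ eqToHom (by rw [h])))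

theorem compMap_mk {g : Z ⟶ Z'} {f : Y ⟶ Y'} {e : X ⟶ X'}
    (a : ∀ z y, M z y ⟶ M' (g z) (f y)) (b : ∀ y x, N y x ⟶ N' (f y) (e x)) :
    compMap (Cell.mk f g a : (⟨Y, Z, M⟩ : HArrow (Mat.{w} V)) ⟶ ⟨Y', Z', M'⟩)
      (Cell.mk e f b : (⟨X, Y, N⟩ : HArrow (Mat.{w} V)) ⟶ ⟨X', Y', N'⟩) rfl =
      Cell.mk e g (compApp a b) := by
  have h : (fun y x => b y x ≫ eqToHom rfl) = b := by
    funext y x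
    simp
  exact congrArg (fun b => Cell.mk (S := ⟨X, Z, comp M N⟩) (T := ⟨X', Z', comp M' N'⟩) e g
    (compApp (g := g) (f := f) (e := e) a b)) h

theorem compMap_congr_left {α α' : (⟨Y, Z, M⟩ : HArrow (Mat.{w} V)) ⟶ ⟨Y', Z', M'⟩}
    (e : α = α') (β : (⟨X, Y, N⟩ : HArrow (Mat.{w} V)) ⟶ ⟨X', Y', N'⟩) (h : α.left = β.right) :
    compMap α β h = compMap α' β (e ▸ h) := by
  subst e
  rfl

theorem compMap_congr_right (α : (⟨Y, Z, M⟩ : HArrow (Mat.{w} V)) ⟶ ⟨Y', Z', M'⟩)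
    {β β' : (⟨X, Y, N⟩ : HArrow (Mat.{w} V)) ⟶ ⟨X', Y', N'⟩} (e : β = β') (h : α.left = β.right) :
    compMap α β h = compMap α β' (e ▸ h) := by
  subst e
  rfl

end CompApp

variable [∀ (A : V) (J : Type w), PreservesColimitsOfShape (Discrete J) (tensorLeft A)]
  [∀ (A : V) (J : Type w), PreservesColimitsOfShape (Discrete J) (tensorRight A)]

section Assoc

variable {U W X Y Z : Type w} (M : Mat V Y Z) (N : Mat V X Y) (P : Mat V W X) (Q : Mat V U W)

/-- The associator, given by the associator of `V` on summands. -/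
def assocHom (z : Z) (v : W) : comp (comp M N) P z v ⟶ comp M (comp N P) z v :=
  compDesc fun x => compDescR fun y =>
    (α_ (M z y) (N y x) (P x v)).hom ≫ M z y ◁ compι N P y x v ≫ compι M (comp N P) z y v

def assocInv (z : Z) (v : W) : comp M (comp N P) z v ⟶ comp (comp M N) P z v :=
  compDesc fun y => compDescL fun x =>
    (α_ (M z y) (N y x) (P x v)).inv ≫ compι M N z y x ▷ P x v ≫ compι (comp M N) P z x v

theorem ι_assocHom (z : Z) (y : Y) (x : X) (v : W) :
    compι M N z y x ▷ P x v ≫ compι (comp M N) P z x v ≫ assocHom M N P z v =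
      (α_ (M z y) (N y x) (P x v)).hom ≫ M z y ◁ compι N P y x v ≫ compι M (comp N P) z y v := by
  rw [assocHom, compι_desc, compι_descR]

theorem ι_assocHom_assoc (z : Z) (y : Y) (x : X) (v : W) {T : V}
    (f : comp M (comp N P) z v ⟶ T) :
    compι M N z y x ▷ P x v ≫ compι (comp M N) P z x v ≫ assocHom M N P z v ≫ f =
      (α_ (M z y) (N y x) (P x v)).hom ≫ M z y ◁ compι N P y x v ≫
        compι M (comp N P) z y v ≫ f := by
  simpa using ι_assocHom M N P z y x v =≫ f

theorem ι_assocInv (z : Z) (y : Y) (x : X) (v : W) :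
    M z y ◁ compι N P y x v ≫ compι M (comp N P) z y v ≫ assocInv M N P z v =
      (α_ (M z y) (N y x) (P x v)).inv ≫ compι M N z y x ▷ P x v ≫
        compι (comp M N) P z x v := by
  rw [assocInv, compι_desc, compι_descL]

theorem hom_ext₃ {z : Z} {v : W} {T : V} {f g : comp (comp M N) P z v ⟶ T}
    (h : ∀ y x, compι M N z y x ▷ P x v ≫ compι (comp M N) P z x v ≫ f =
      compι M N z y x ▷ P x v ≫ compι (comp M N) P z x v ≫ g) : f = g :=
  comp_hom_ext fun x => comp_hom_extR fun y => h y x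

theorem hom_ext₃' {z : Z} {v : W} {T : V} {f g : comp M (comp N P) z v ⟶ T}
    (h : ∀ y x, M z y ◁ compι N P y x v ≫ compι M (comp N P) z y v ≫ f =
      M z y ◁ compι N P y x v ≫ compι M (comp N P) z y v ≫ g) : f = g :=
  comp_hom_ext fun y => comp_hom_extL fun x => h y x

theorem hom_ext₄ {z : Z} {v : U} {T : V} {f g : comp (comp (comp M N) P) Q z v ⟶ T}
    (h : ∀ y x t, (compι M N z y x ▷ P x t) ▷ Q t v ≫ compι (comp M N) P z x t ▷ Q t v ≫
      compι (comp (comp M N) P) Q z t v ≫ f =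
      (compι M N z y x ▷ P x t) ▷ Q t v ≫ compι (comp M N) P z x t ▷ Q t v ≫
      compι (comp (comp M N) P) Q z t v ≫ g) : f = g := by
  refine hom_ext₃ (comp M N) P Q fun x t => ?_
  rw [← cancel_epi (α_ (comp M N z x) (P x t) (Q t v)).inv]
  refine comp_hom_extR fun y => ?_
  have h' := (α_ (M z y ⊗ N y x) (P x t) (Q t v)).inv ≫= h y x t
  rw [associator_inv_naturality_left_assoc, associator_inv_naturality_left_assoc]
  exact h'

def assocIso (z : Z) (v : W) : comp (comp M N) P z v ≅ comp M (comp N P) z v where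
  hom := assocHom M N P z v
  inv := assocInv M N P z v
  hom_inv_id := hom_ext₃ M N P fun y x => by
    rw [ι_assocHom_assoc, ι_assocInv]
    simp
  inv_hom_id := hom_ext₃' M N P fun y x => by
    have h := ι_assocInv M N P z y x v =≫ assocHom M N P z v
    simp only [Category.assoc] at h
    rw [h, ι_assocHom]
    simp

theorem assocHom_naturality {W' X' Y' Z' : Type w} {M : Mat V Y Z} {N : Mat V X Y} {P : Mat V W X}
    {M' : Mat V Y' Z'} {N' : Mat V X' Y'} {P' : Mat V W' X'} {g : Z → Z'} {f : Y → Y'}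
    {e : X → X'} {d : W → W'} (a : ∀ z y, M z y ⟶ M' (g z) (f y))
    (b : ∀ y x, N y x ⟶ N' (f y) (e x)) (c : ∀ x v, P x v ⟶ P' (e x) (d v)) (z : Z) (v : W) :
    compApp (compApp a b) c z v ≫ assocHom M' N' P' (g z) (d v) =
      assocHom M N P z v ≫ compApp a (compApp b c) z v :=
  hom_ext₃ M N P fun y x => by
    rw [ι_compApp_assoc, ι_assocHom_assoc, ι_compApp]
    have h₁ : compι M N z y x ▷ P x v ≫ (compApp a b z x ⊗ₘ c x v) =
        ((a z y ⊗ₘ b y x) ⊗ₘ c x v) ≫ compι M' N' (g z) (f y) (e x) ▷ P' (e x) (d v) := by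
      rw [← tensorHom_id, ← tensorHom_id, tensorHom_comp_tensorHom, tensorHom_comp_tensorHom,
        ι_compApp, Category.id_comp, Category.comp_id]
    have h₂ : M z y ◁ compι N P y x v ≫ (a z y ⊗ₘ compApp b c y v) =
        (a z y ⊗ₘ (b y x ⊗ₘ c x v)) ≫ M' (g z) (f y) ◁ compι N' P' (f y) (e x) (d v) := by
      rw [← id_tensorHom, ← id_tensorHom, tensorHom_comp_tensorHom, tensorHom_comp_tensorHom,
        ι_compApp, Category.id_comp, Category.comp_id]
    rw [reassoc_of% h₁, reassoc_of% h₂, ι_assocHom, associator_naturality_assoc]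

theorem assocHom_pentagon (z : Z) (v : U) :
    compApp (g := fun z => z) (f := fun y => y) (e := fun x => x)
      (assocHom M N P) (fun t v => 𝟙 (Q t v)) z v ≫
      assocHom M (comp N P) Q z v ≫
        compApp (g := fun z => z) (f := fun y => y) (e := fun x => x)
          (fun z y => 𝟙 (M z y)) (assocHom N P Q) z v =
      assocHom (comp M N) P Q z v ≫ assocHom M N (comp P Q) z v :=
  hom_ext₄ M N P Q fun y x t => by
    have h₁ : compι M N z y x ▷ P x t ▷ Q t v ≫ compι (comp M N) P z x t ▷ Q t v ≫
        assocHom M N P z t ▷ Q t v =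
        (α_ (M z y) (N y x) (P x t)).hom ▷ Q t v ≫ (M z y ◁ compι N P y x t) ▷ Q t v ≫
          compι M (comp N P) z y t ▷ Q t v := by
      simp only [← comp_whiskerRight, ι_assocHom]
    have h₂ : M z y ◁ (compι N P y x t ▷ Q t v) ≫ M z y ◁ compι (comp N P) Q y t v ≫
        M z y ◁ assocHom N P Q y v =
        M z y ◁ (α_ (N y x) (P x t) (Q t v)).hom ≫ M z y ◁ (N y x ◁ compι P Q x t v) ≫
          M z y ◁ compι N (comp P Q) y x v := by
      simp only [← whiskerLeft_comp, ι_assocHom]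
    have h₃ : compι (comp M N) P z x t ▷ Q t v ≫
        compι (comp (comp M N) P) Q z t v ≫ assocHom (comp M N) P Q z v =
        _ := ι_assocHom (comp M N) P Q z x t v
    rw [ι_compApp_assoc, tensorHom_id, reassoc_of% h₁, ι_assocHom_assoc, ι_compApp,
      id_tensorHom, associator_naturality_middle_assoc, reassoc_of% h₂, reassoc_of% h₃,
      associator_naturality_left_assoc, ← whisker_exchange_assoc, ι_assocHom,
      associator_naturality_right_assoc, pentagon_assoc]

end Assoc

section Unitors

variable {X Y : Type w} (M : Mat V X Y)

def leftUnitorHom (y : Y) (x : X) : comp (unit Y) M y x ⟶ M y x :=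
  compDesc fun y' => unitDescR (p := y' = y) fun h => eqToHom (by rw [h])

theorem ι_leftUnitorHom (y : Y) (x : X) :
    idι y ▷ M y x ≫ compι (unit Y) M y y x ≫ leftUnitorHom M y x = (λ_ (M y x)).hom := by
  exact (congrArg _ (compι_desc _ _)).trans ((unitι_descR _ rfl).trans (by simp))

theorem ι_leftUnitorHom_assoc (y : Y) (x : X) {T : V} (f : M y x ⟶ T) :
    idι y ▷ M y x ≫ compι (unit Y) M y y x ≫ leftUnitorHom M y x ≫ f = (λ_ (M y x)).hom ≫ f := by
  simpa using ι_leftUnitorHom M y x =≫ f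

theorem leftUnitor_ext {y : Y} {x : X} {T : V} {f g : comp (unit Y) M y x ⟶ T}
    (h : idι y ▷ M y x ≫ compι (unit Y) M y y x ≫ f =
      idι y ▷ M y x ≫ compι (unit Y) M y y x ≫ g) : f = g :=
  comp_hom_ext fun y' => unit_hom_extR (p := y' = y) fun e => by
    subst e
    exact h

def leftUnitorIso (y : Y) (x : X) : comp (unit Y) M y x ≅ M y x where
  hom := leftUnitorHom M y x
  inv := (λ_ (M y x)).inv ≫ idι y ▷ M y x ≫ compι (unit Y) M y y x
  hom_inv_id := leftUnitor_ext M (by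
    rw [ι_leftUnitorHom_assoc]
    simp)
  inv_hom_id := by
    simp only [Category.assoc]
    rw [ι_leftUnitorHom]
    simp

def rightUnitorHom (y : Y) (x : X) : comp M (unit X) y x ⟶ M y x :=
  compDesc fun x' => unitDescL (p := x = x') fun h => eqToHom (by rw [h])

theorem ι_rightUnitorHom (y : Y) (x : X) :
    M y x ◁ idι x ≫ compι M (unit X) y x x ≫ rightUnitorHom M y x = (ρ_ (M y x)).hom := by
  exact (congrArg _ (compι_desc _ _)).trans ((unitι_descL _ rfl).trans (by simp))

theorem ι_rightUnitorHom_assoc (y : Y) (x : X) {T : V} (f : M y x ⟶ T) :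
    M y x ◁ idι x ≫ compι M (unit X) y x x ≫ rightUnitorHom M y x ≫ f =
      (ρ_ (M y x)).hom ≫ f := by
  simpa using ι_rightUnitorHom M y x =≫ f

theorem rightUnitor_ext {y : Y} {x : X} {T : V} {f g : comp M (unit X) y x ⟶ T}
    (h : M y x ◁ idι x ≫ compι M (unit X) y x x ≫ f =
      M y x ◁ idι x ≫ compι M (unit X) y x x ≫ g) : f = g :=
  comp_hom_ext fun x' => unit_hom_extL (p := x = x') fun e => by
    subst e
    exact h

def rightUnitorIso (y : Y) (x : X) : comp M (unit X) y x ≅ M y x where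
  hom := rightUnitorHom M y x
  inv := (ρ_ (M y x)).inv ≫ M y x ◁ idι x ≫ compι M (unit X) y x x
  hom_inv_id := rightUnitor_ext M (by
    rw [ι_rightUnitorHom_assoc]
    simp)
  inv_hom_id := by
    simp only [Category.assoc]
    rw [ι_rightUnitorHom]
    simp

variable {M} {X' Y' : Type w} {M' : Mat V X' Y'} {g : Y → Y'} {f : X → X'}

theorem leftUnitorHom_naturality (a : ∀ y x, M y x ⟶ M' (g y) (f x)) (y : Y) (x : X) :
    compApp (unitApp g) a y x ≫ leftUnitorHom M' (g y) (f x) = leftUnitorHom M y x ≫ a y x :=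
  leftUnitor_ext M (by
    have h : idι y ▷ M y x ≫ (unitApp g y y ⊗ₘ a y x) =
        𝟙_ V ◁ a y x ≫ idι (g y) ▷ M' (g y) (f x) := by
      rw [← tensorHom_id, ← tensorHom_id, ← id_tensorHom, tensorHom_comp_tensorHom,
        tensorHom_comp_tensorHom, idι_unitApp, Category.id_comp, Category.id_comp,
        Category.comp_id]
    rw [ι_compApp_assoc, reassoc_of% h, ι_leftUnitorHom, ι_leftUnitorHom_assoc,
      leftUnitor_naturality])

theorem rightUnitorHom_naturality (a : ∀ y x, M y x ⟶ M' (g y) (f x)) (y : Y) (x : X) :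
    compApp a (unitApp f) y x ≫ rightUnitorHom M' (g y) (f x) = rightUnitorHom M y x ≫ a y x :=
  rightUnitor_ext M (by
    have h : M y x ◁ idι x ≫ (a y x ⊗ₘ unitApp f x x) =
        a y x ▷ 𝟙_ V ≫ M' (g y) (f x) ◁ idι (f x) := by
      rw [← id_tensorHom, ← tensorHom_id, ← id_tensorHom, tensorHom_comp_tensorHom,
        tensorHom_comp_tensorHom, idι_unitApp, Category.id_comp, Category.id_comp,
        Category.comp_id]
    rw [ι_compApp_assoc, reassoc_of% h, ι_rightUnitorHom, ι_rightUnitorHom_assoc,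
      rightUnitor_naturality])

theorem unitor_triangle {X Y Z : Type w} (M : Mat V Y Z) (N : Mat V X Y) (z : Z) (x : X) :
    assocHom M (unit Y) N z x ≫
      compApp (g := fun z => z) (f := fun y => y) (e := fun x => x)
        (fun z y => 𝟙 (M z y)) (leftUnitorHom N) z x =
      compApp (g := fun z => z) (f := fun y => y) (e := fun x => x)
        (rightUnitorHom M) (fun y x => 𝟙 (N y x)) z x :=
  comp_hom_ext fun y => by
    rw [← cancel_epi ((rightUnitorIso M z y).inv ▷ N y x), ι_compApp, tensorHom_id]
    have h₁ : (rightUnitorIso M z y).inv ▷ N y x ≫ rightUnitorHom M z y ▷ N y x = 𝟙 _ := by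
      rw [← comp_whiskerRight]
      exact (congrArg (· ▷ N y x) (rightUnitorIso M z y).inv_hom_id).trans (id_whiskerRight _ _)
    have h₂ : (rightUnitorIso M z y).inv ▷ N y x = (ρ_ (M z y)).inv ▷ N y x ≫
        (M z y ◁ idι y) ▷ N y x ≫ compι M (unit Y) z y y ▷ N y x := by
      simp [rightUnitorIso]
    have h₃ : M z y ◁ (idι y ▷ N y x) ≫ M z y ◁ compι (unit Y) N y y x ≫
        M z y ◁ leftUnitorHom N y x = M z y ◁ (λ_ (N y x)).hom := by
      simp only [← whiskerLeft_comp, ι_leftUnitorHom]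
    rw [reassoc_of% h₁, h₂]
    simp only [Category.assoc]
    rw [ι_assocHom_assoc, ι_compApp, id_tensorHom, associator_naturality_middle_assoc,
      reassoc_of% h₃]
    simp

end Unitors

end Double

end VMat

open VMat in
/-- The double category `V-𝕄at` of `V`-matrices, for `V` a monoidal category with small coproducts
preserved by `⊗` in each variable. Its category of objects is the category of small sets. -/
def vMat (V : Type u) [Category.{w} V] [MonoidalCategory V] [HasCoproducts.{w} V]
    [∀ (A : V) (J : Type w), PreservesColimitsOfShape (Discrete J) (tensorLeft A)]
    [∀ (A : V) (J : Type w), PreservesColimitsOfShape (Discrete J) (tensorRight A)] :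
    PseudoDoubleCategory.{w, w, w + 1, max u w} where
  Obj := Type w
  Hor := Mat V
  catArr := matCategory
  srcMap α := Cell.left α
  tgtMap α := Cell.right α
  srcMap_id _ := rfl
  tgtMap_id _ := rfl
  srcMap_comp _ _ := rfl
  tgtMap_comp _ _ := rfl
  unit := unit
  unitMap f := Cell.mk f f (unitApp f)
  srcMap_unitMap _ := rfl
  tgtMap_unitMap _ := rfl
  unitMap_id X := Cell.mk_ext (unitMat_ext fun x =>
    (idι_unitApp (fun x => x) x).trans (Category.comp_id _).symm)
  unitMap_comp f g := Cell.mk_ext (unitMat_ext fun x =>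
    (idι_unitApp (fun x => g (f x)) x).trans (idι_unitApp_comp f g x).symm)
  comp := comp
  compMap := compMap
  srcMap_compMap _ _ _ := rfl
  tgtMap_compMap _ _ _ := rfl
  compMap_id M N := (compMap_mk _ _).trans (Cell.mk_ext compApp_id)
  compMap_comp := by
    rintro X Y Z X' Y' Z' X'' Y'' Z'' M N M' N' M'' N'' ⟨f, g, a⟩ ⟨e, k, b⟩ ⟨f', g', a'⟩
      ⟨e', k', b'⟩ h h'
    obtain rfl : f = k := h
    obtain rfl : f' = k' := h'
    exact (compMap_mk _ _).trans ((Cell.mk_ext (compApp_comp a b a' b')).trans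
      (congrArg₂ (· ≫ ·) (compMap_mk a b) (compMap_mk a' b')).symm)
  assoc M N P := globularIso (assocIso M N P)
  srcMap_assoc _ _ _ := rfl
  tgtMap_assoc _ _ _ := rfl
  assoc_naturality := by
    rintro W X Y Z W' X' Y' Z' M N P M' N' P' ⟨f, g, a⟩ ⟨e, k, b⟩ ⟨d, l, c⟩ h h'
    obtain rfl : f = k := h
    obtain rfl : e = l := h'
    exact (congrArg (· ≫ (globularIso (assocIso M' N' P')).hom)
      ((compMap_congr_left (compMap_mk a b) _ rfl).trans (compMap_mk (compApp a b) c))).trans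
      ((Cell.mk_ext (assocHom_naturality a b c)).trans
      (congrArg ((globularIso (assocIso M N P)).hom ≫ ·)
        ((compMap_congr_right _ (compMap_mk b c) rfl).trans (compMap_mk a (compApp b c)))).symm)
  leftUnitor M := globularIso (leftUnitorIso M)
  srcMap_leftUnitor _ := rfl
  tgtMap_leftUnitor _ := rfl
  leftUnitor_naturality := by
    rintro X Y X' Y' M M' ⟨f, g, a⟩
    exact (congrArg (· ≫ (globularIso (leftUnitorIso M')).hom) (compMap_mk _ _)).trans
      (Cell.mk_ext (leftUnitorHom_naturality a))
  rightUnitor M := globularIso (rightUnitorIso M)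
  srcMap_rightUnitor _ := rfl
  tgtMap_rightUnitor _ := rfl
  rightUnitor_naturality := by
    rintro X Y X' Y' M M' ⟨f, g, a⟩
    exact (congrArg (· ≫ (globularIso (rightUnitorIso M')).hom) (compMap_mk _ _)).trans
      (Cell.mk_ext (rightUnitorHom_naturality a))
  pentagon M N P Q :=
    (congrArg₂ (fun α β => α ≫ (globularIso (assocIso M (comp N P) Q)).hom ≫ β)
      (compMap_mk _ _) (compMap_mk _ _)).trans (Cell.mk_ext (assocHom_pentagon M N P Q))
  triangle M N :=
    (congrArg ((globularIso (assocIso M (unit _) N)).hom ≫ ·) (compMap_mk _ _)).trans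
      ((Cell.mk_ext (unitor_triangle M N)).trans (compMap_mk _ _).symm)

end

/-! Every category in the statement is, up to equivalence, a category of families `Fam P W`: objects
are pairs of an object `b` of `B` and a family `P b → W`, that is, the Grothendieck construction of
`b ↦ W ^ (P b)`. Matrices with both ends free are the case `P (Y, X) = Y × X`, `W = V`; matrices
with fixed domain (codomain) `X` are the case `P = 𝟭`, `W = X → V`, a set-indexed family of rows
(columns).

Colimits in `Fam P W` are explicit for arbitrary `P`: take the colimit of the bases, and over a
point `p` of it take the colimit of all members whose index is sent to `p` (`isColimitOfFib`). If
`P` is `κ`-accessible and the diagram is `κ`-filtered, the category indexing this fibre is again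
`κ`-filtered (`Elt.isCardinalFiltered`). Hence a family freely generated by a `κ`-presentable `G`
over a point of a `κ`-presentable base is `κ`-presentable. Together with the families of initial
objects over generating bases, such families form a small strong generator, so `Fam P W` is locally
`κ`-presentable when `B` and `W` are (`Fam.isCardinalLocallyPresentable`). Powers of `V` are treated
by the same pattern, and the cardinal `κ` of `V` serves for all these categories.

Source and target become the base functor followed by a coordinate; both are cocontinuous and have
left adjoints. Composition with `M` becomes the memberwise application of a matrix of functors `- ⊗
M y x` or `M y x ⊗ -`. Since `⊗` is cocontinuous in each variable, this preserves all small colimits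
and is in particular accessible. For fibrancy, the companion and conjoint of `f` are the unit matrix
of the codomain restricted along `f` in one variable; their identities reduce to `λ_ I = ρ_ I`. -/

noncomputable section

/-! ### The category of families and its forgetful functor -/

/-- The category of families of objects of `W` indexed by the values of a functor
`P : B ⥤ Type w`: an object is an object `b` of `B` together with a family `P b → W`. -/
structure Fam {B : Type u₀} [Category.{w} B] (P : B ⥤ Type w) (W : Type u₁) where
  base : B
  fib : P.obj base → W

namespace Fam

section Category

variable {B : Type u₀} [Category.{w} B] {P : B ⥤ Type w} {W : Type u₁} [Category.{w} W]

/-- A morphism of families. The components are indexed by all `p`, `q` such that `q` is the image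
of `p`, so that equalities between morphisms can be stated without transport. -/
structure Hom (S T : Fam P W) where
  base : S.base ⟶ T.base
  app (p : P.obj S.base) (q : P.obj T.base) (h : P.map base p = q) : S.fib p ⟶ T.fib q

theorem Hom.ext_app {S T : Fam P W} {α β : Hom S T} (hb : α.base = β.base)
    (h : ∀ p q hα hβ, α.app p q hα = β.app p q hβ) : α = β := by
  obtain ⟨a, a'⟩ := α
  obtain ⟨b, b'⟩ := β
  obtain rfl : a = b := hb
  congr
  funext p q e
  exact h p q e e

instance : Category.{w} (Fam P W) where
  Hom := Hom
  id S := ⟨𝟙 _, fun p q h => eqToHom (by rw [← h]; simp)⟩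
  comp α β := ⟨α.base ≫ β.base, fun p q h => α.app p _ rfl ≫ β.app _ q (by rw [← h]; simp)⟩
  id_comp α := Hom.ext_app (Category.id_comp _) fun p q h h' => by
    -- The composite uses `α` at `P.map (𝟙 _) p`, which equals `p` only propositionally; with a
    -- variable `p'` in its place the equality can be eliminated.
    have key : ∀ p' (e : p = p') (h : P.map α.base p' = q),
        eqToHom (by rw [e]) ≫ α.app p' q h = α.app p q h' := by
      rintro _ rfl h
      simp
    exact key _ (by simp) _
  comp_id α := Hom.ext_app (Category.comp_id _) fun p q h h' => by
    subst h'
    simp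
  assoc α β γ := Hom.ext_app (Category.assoc _ _ _) fun p q h h' => by
    have key : ∀ r r' (e : r = r') (h₁ : P.map β.base (P.map α.base p) = r)
        (h₁' : P.map β.base (P.map α.base p) = r') (h₂ : P.map γ.base r = q)
        (h₂' : P.map γ.base r' = q), β.app _ r h₁ ≫ γ.app r q h₂ =
          β.app _ r' h₁' ≫ γ.app r' q h₂' := by
      rintro r _ rfl _ _ _ _
      rfl
    simp only [Category.assoc]
    exact congrArg _ (key _ _ (by simp) _ _ _ _)

theorem hom_ext {S T : Fam P W} {α β : S ⟶ T} (hb : α.base = β.base)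
    (h : ∀ p q hα hβ, α.app p q hα = β.app p q hβ) : α = β :=
  Hom.ext_app hb h

@[simp]
theorem id_base (S : Fam P W) : Hom.base (𝟙 S) = 𝟙 S.base := rfl

@[simp]
theorem comp_base {S T R : Fam P W} (α : S ⟶ T) (β : T ⟶ R) :
    (α ≫ β).base = α.base ≫ β.base := rfl

@[simp]
theorem id_app (S : Fam P W) (p : P.obj S.base) (h) : Hom.app (𝟙 S) p p h = 𝟙 _ := rfl

theorem comp_app {S T R : Fam P W} (α : S ⟶ T) (β : T ⟶ R) {p : P.obj S.base} {q : P.obj T.base}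
    {r : P.obj R.base} (h₁ : P.map α.base p = q) (h₂ : P.map β.base q = r) (h) :
    (α ≫ β).app p r h = α.app p q h₁ ≫ β.app q r h₂ := by
  subst h₁
  rfl

theorem app_congr {S T : Fam P W} {α β : S ⟶ T} (e : α = β) (p q h) :
    α.app p q h = β.app p q (e ▸ h) := by
  subst e
  rfl

/-- A morphism of families which is invertible on the bases and componentwise is invertible. -/
theorem isIso_of_app {S T : Fam P W} (α : S ⟶ T) [IsIso α.base]
    (h : ∀ p q e, IsIso (α.app p q e)) : IsIso α := by
  have hq (q p) (e : P.map (inv α.base) q = p) : P.map α.base p = q := by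
    rw [← e, ← Functor.map_comp_apply]
    simp
  let β : T ⟶ S := ⟨inv α.base, fun q p e => inv (α.app p q (hq q p e))⟩
  refine ⟨β, hom_ext (by simp [β]) fun p p' e e' => ?_, hom_ext (by simp [β]) fun q q' e e' => ?_⟩
  · obtain rfl : p = p' := by simpa using e'
    have h₂ : P.map β.base (P.map α.base p) = p := by
      rw [← Functor.map_comp_apply]
      simp [β]
    rw [comp_app α β rfl h₂]
    simp [β]
  · obtain rfl : q = q' := by simpa using e'
    rw [comp_app β α rfl (hq _ _ rfl)]
    simp [β]

variable (P W) in
/-- The functor sending a family to its base. -/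
@[simps]
def forget : Fam P W ⥤ B where
  obj S := S.base
  map α := α.base

variable [HasInitial W]

/-- A morphism out of the family of initial objects over `b` is a morphism out of `b`. -/
def freeHomEquiv (b : B) (S : Fam P W) :
    ((⟨b, fun _ => ⊥_ W⟩ : Fam P W) ⟶ S) ≃ (b ⟶ S.base) where
  toFun α := α.base
  invFun f := ⟨f, fun _ _ _ => initial.to _⟩
  left_inv _ := hom_ext rfl fun _ _ _ _ => initial.hom_ext _ _
  right_inv _ := rfl

variable (P W) in
/-- The functor sending `b` to the family of initial objects over `b`. -/
def free : B ⥤ Fam P W :=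
  Adjunction.leftAdjointOfEquiv (G := forget P W) freeHomEquiv fun _ _ _ _ _ => rfl

variable (P W) in
/-- The functor `free` is left adjoint to the forgetful functor. -/
def freeAdj : free P W ⊣ forget P W :=
  Adjunction.adjunctionOfEquivLeft _ _

end Category

/-! ### Elements of a diagram of sets over a point of its colimit -/

/-- The elements of a diagram of types over a given element of the target of a family of maps. -/
structure Elt {J : Type w} [SmallCategory J] (Q : J ⥤ Type w) {X : Type w}
    (ι : ∀ j, Q.obj j ⟶ X) (p : X) where
  idx : J
  val : Q.obj idx
  ι_val : ι idx val = p

namespace Elt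

variable {J : Type w} [SmallCategory J] {Q : J ⥤ Type w}

instance {X : Type w} (ι : ∀ j, Q.obj j ⟶ X) (p : X) : SmallCategory (Elt Q ι p) where
  Hom x y := { f : x.idx ⟶ y.idx // Q.map f x.val = y.val }
  id x := ⟨𝟙 _, by simp⟩
  comp f g := ⟨f.1 ≫ g.1, by rw [Functor.map_comp_apply, f.2, g.2]⟩

/-- The projection to the index category. -/
@[simps]
def proj {X : Type w} (ι : ∀ j, Q.obj j ⟶ X) (p : X) : Elt Q ι p ⥤ J where
  obj x := x.idx
  map f := f.1

/-- A `κ`-small diagram of elements has a cocone on its indices, since `J` is `κ`-filtered. The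
transported values may still differ there, but all represent `p`. As there are fewer than `κ` of
them, they become equal at one later stage. -/
theorem isCardinalFiltered {c : Cocone Q} (hc : IsColimit c) (p : c.pt) (κ : Cardinal.{w})
    [Fact κ.IsRegular] [IsCardinalFiltered J κ] :
    IsCardinalFiltered (Elt Q (fun j => c.ι.app j) p) κ where
  nonempty_cocone {A} _ F hA := by
    have := isFiltered_of_isCardinalFiltered J κ
    have hA' : HasCardinalLT A κ := hasCardinalLT_of_hasCardinalLT_arrow hA
    have := hA'.isCardinalPresentable
    obtain ⟨i, q, hq⟩ := Types.jointly_surjective_of_isColimit hc p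
    let d := IsCardinalFiltered.cocone (F ⋙ proj _ p) hA
    -- A fixed representative `q` of `p` is compared with all transported values at once, `A` being
    -- a `κ`-presentable set. The image of `q` is then the vertex, also when `A` is empty.
    let f₁ : A ⟶ Q.obj i := TypeCat.ofHom fun _ => q
    let f₂ : A ⟶ Q.obj d.pt := TypeCat.ofHom fun a => Q.map (d.ι.app a) (F.obj a).val
    obtain ⟨k, u, v, h⟩ := IsCardinalPresentable.exists_eq_of_isColimit κ hc f₁ f₂ (by
      ext a
      exact hq.trans ((F.obj a).ι_val.symm.trans
        (ConcreteCategory.congr_hom (c.w (d.ι.app a)) (F.obj a).val).symm))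
    refine ⟨⟨⟨k, Q.map u q, ?_⟩, ⟨fun a => ⟨d.ι.app a ≫ v, ?_⟩, fun a b f => Subtype.ext ?_⟩⟩⟩
    · rw [← hq]
      exact ConcreteCategory.congr_hom (c.w u) q
    · exact (Functor.map_comp_apply Q _ _ _).trans (ConcreteCategory.congr_hom h a).symm
    · exact (Category.assoc _ _ _).symm.trans
        ((d.w f =≫ v).trans (Category.comp_id _).symm)

end Elt

/-! ### Colimits of families, computed on bases and fibres -/

section Colimits

variable {B : Type u₀} [Category.{w} B] {P : B ⥤ Type w} {W : Type u₁} [Category.{w} W]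
  {J : Type w} [SmallCategory J]

/-- The index category of the fibres of a diagram of families over an element of a base. -/
abbrev FibIdx (F : J ⥤ Fam P W) {b : B} (ι : ∀ j, (F.obj j).base ⟶ b) (p : P.obj b) : Type w :=
  Elt (F ⋙ forget P W ⋙ P) (fun j => P.map (ι j)) p

/-- The diagram of the fibres of a diagram of families over a given element of the base. -/
def fibDiag (F : J ⥤ Fam P W) {b : B} (ι : ∀ j, (F.obj j).base ⟶ b) (p : P.obj b) :
    FibIdx F ι p ⥤ W where
  obj x := (F.obj x.idx).fib x.val
  map f := (F.map f.1).app _ _ f.2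
  map_id x := app_congr (F.map_id x.idx) _ _ _
  map_comp f g := (app_congr (F.map_comp f.1 g.1) _ _ _).trans (comp_app _ _ f.2 g.2 _)

/-- The cocone over the diagram of fibres given by a cocone over a diagram of families. -/
def fibCocone {F : J ⥤ Fam P W} (c : Cocone F) (p : P.obj c.pt.base) :
    Cocone (fibDiag F (fun j => (c.ι.app j).base) p) where
  pt := c.pt.fib p
  ι :=
    { app x := (c.ι.app x.idx).app x.val p x.ι_val
      naturality x y f :=
        ((comp_app (F.map f.1) (c.ι.app y.idx) f.2 y.ι_val (by
          rw [c.w]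
          exact x.ι_val)).symm.trans (app_congr (c.w f.1) _ _ _)).trans
          (Category.comp_id _).symm }

/-- A cocone of families is a colimit cocone as soon as the underlying cocone of bases and all
the cocones of fibres are. -/
def isColimitOfFib {F : J ⥤ Fam P W} (c : Cocone F) (hb : IsColimit ((forget P W).mapCocone c))
    (hf : ∀ p, IsColimit (fibCocone c p)) : IsColimit c := by
  let b (s : Cocone F) : c.pt.base ⟶ s.pt.base := hb.desc ((forget P W).mapCocone s)
  have hfac (s : Cocone F) (j : J) : (c.ι.app j).base ≫ b s = (s.ι.app j).base :=
    hb.fac ((forget P W).mapCocone s) j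
  have hval (s : Cocone F) {p q} (h : P.map (b s) p = q)
      (x : FibIdx F (fun j => (c.ι.app j).base) p) :
      P.map (s.ι.app x.idx).base x.val = q := by
    rw [← h, ← hfac]
    exact (Functor.map_comp_apply P _ _ _).trans (congrArg _ x.ι_val)
  -- Keeping `q` free, subject to `h`, gives the components of the descended morphism in exactly the
  -- form required by `Hom.app`.
  let t (s : Cocone F) (p q) (h : P.map (b s) p = q) :
      Cocone (fibDiag F (fun j => (c.ι.app j).base) p) :=
    { pt := s.pt.fib q
      ι :=
        { app x := (s.ι.app x.idx).app x.val q (hval s h x)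
          naturality x y f :=
            ((comp_app (F.map f.1) (s.ι.app y.idx) f.2 (hval s h y) (by
              rw [s.w]
              exact hval s h x)).symm.trans (app_congr (s.w f.1) _ _ _)).trans
              (Category.comp_id _).symm } }
  exact
    { desc s := ⟨b s, fun p q h => (hf p).desc (t s p q h)⟩
      fac s j := hom_ext (hfac s j) fun p q h h' => by
        have e : P.map (b s) (P.map (c.ι.app j).base p) = q :=
          (Functor.map_comp_apply P _ _ _).symm.trans h
        exact (comp_app _ _ rfl e _).trans ((hf _).fac (t s _ q e) ⟨j, p, rfl⟩)
      uniq s m hm := by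
        have hmb : m.base = b s :=
          hb.uniq ((forget P W).mapCocone s) m.base fun j => congrArg Hom.base (hm j)
        refine hom_ext hmb fun p q h h' => (hf p).hom_ext fun x => ?_
        refine Eq.trans ?_ ((hf p).fac (t s p q h') x).symm
        exact (comp_app (c.ι.app x.idx) m x.ι_val h (by
          rw [hm]
          exact hval s h' x)).symm.trans (app_congr (hm x.idx) _ _ _) }

variable (F : J ⥤ Fam P W) [HasColimit (F ⋙ forget P W)] [HasColimitsOfSize.{w, w} W]

/-- The colimit of a diagram of families. -/
def colimitCocone : Cocone F where
  pt := ⟨colimit (F ⋙ forget P W),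
    -- Nothing is asked of `P`: a point `p` reached from no stage has an empty index category, so
    -- the member there is initial.
    fun p => colimit (fibDiag F (colimit.ι (F ⋙ forget P W)) p)⟩
  ι :=
    { app j := ⟨colimit.ι (F ⋙ forget P W) j, fun q p h =>
        colimit.ι (fibDiag F (colimit.ι (F ⋙ forget P W)) p) ⟨j, q, h⟩⟩
      naturality i j f := by
        refine (hom_ext (colimit.w (F ⋙ forget P W) f) fun p q h h' => ?_).trans
          (Category.comp_id _).symm
        have e := (Functor.map_comp_apply P _ _ _).symm.trans h
        let x : FibIdx F (colimit.ι (F ⋙ forget P W)) q := ⟨i, p, h'⟩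
        let y : FibIdx F (colimit.ι (F ⋙ forget P W)) q := ⟨j, P.map (F.map f).base p, e⟩
        let g : x ⟶ y := ⟨f, rfl⟩
        exact (comp_app _ _ rfl e _).trans
          (colimit.w (fibDiag F (colimit.ι (F ⋙ forget P W)) q) g) }

/-- The bases of `colimitCocone F` form a colimit cocone. -/
def isColimitForgetColimitCocone : IsColimit ((forget P W).mapCocone (colimitCocone F)) :=
  colimit.isColimit (F ⋙ forget P W)

/-- The fibres of `colimitCocone F` form colimit cocones. -/
def isColimitFibColimitCocone (p) : IsColimit (fibCocone (colimitCocone F) p) :=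
  colimit.isColimit (fibDiag F (b := (colimitCocone F).pt.base)
    (fun j => ((colimitCocone F).ι.app j).base) p)

/-- The cocone `colimitCocone F` is a colimit cocone. -/
def isColimitColimitCocone : IsColimit (colimitCocone F) :=
  isColimitOfFib _ (isColimitForgetColimitCocone F) (isColimitFibColimitCocone F)

end Colimits

section Cocomplete

variable {B : Type u₀} [Category.{w} B] (P : B ⥤ Type w) (W : Type u₁) [Category.{w} W]
  [HasColimitsOfSize.{w, w} B] [HasColimitsOfSize.{w, w} W]

instance : HasColimitsOfSize.{w, w} (Fam P W) where
  has_colimits_of_shape _ _ := ⟨fun F => ⟨⟨_, isColimitColimitCocone F⟩⟩⟩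

instance : PreservesColimitsOfSize.{w, w} (forget P W) where
  preservesColimitsOfShape :=
    ⟨fun {F} => preservesColimit_of_preserves_colimit_cocone (isColimitColimitCocone F)
      (isColimitForgetColimitCocone F)⟩

end Cocomplete

/-! ### Memberwise application of a functor -/

section Map

variable {B : Type u₀} [Category.{w} B] (P : B ⥤ Type w) {W : Type u₁} [Category.{w} W]
  {W' : Type u} [Category.{w} W']

/-- The functor between categories of families given by applying a functor to the members. -/
@[simps]
def map (Φ : W ⥤ W') : Fam P W ⥤ Fam P W' where
  obj S := ⟨S.base, fun p => Φ.obj (S.fib p)⟩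
  map α := ⟨α.base, fun p q h => Φ.map (α.app p q h)⟩
  map_id S := hom_ext rfl fun p q h h' => by
    obtain rfl : p = q := by simpa using h
    exact Φ.map_id _
  map_comp α β := hom_ext rfl fun p q h h' => Φ.map_comp _ _

/-- The criterion `isColimitOfFib` applies to the image cocone: the bases are unchanged, and `Φ`
carries each fibre colimit to a colimit. -/
instance [HasColimitsOfSize.{w, w} B] [HasColimitsOfSize.{w, w} W] (Φ : W ⥤ W')
    [PreservesColimitsOfSize.{w, w} Φ] : PreservesColimitsOfSize.{w, w} (map P Φ) where
  preservesColimitsOfShape :=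
    ⟨fun {F} => preservesColimit_of_preserves_colimit_cocone (isColimitColimitCocone F)
      (by
        have h (p : P.obj (colimitCocone F).pt.base) :=
          isColimitOfPreserves Φ (isColimitFibColimitCocone F p)
        exact isColimitOfFib _ (isColimitForgetColimitCocone F) h)⟩

end Map

end Fam

namespace Fam

/-! ### Families freely generated by one object over one point -/

section Single

variable {B : Type u₀} [Category.{w} B] {P : B ⥤ Type w} {W : Type u₁} [Category.{w} W]
  [HasCoproducts.{w} W]

/-- The family over `b` freely generated by an object `G` placed over `p`. -/
def single (b : B) (p : P.obj b) (G : W) : Fam P W :=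
  -- The coproduct is indexed by a proposition: it is `G` at `q = p` and initial at every other `q`.
  ⟨b, fun q => ∐ fun _ : ULift.{w} (PLift (p = q)) => G⟩

section

variable {b : B} {p : P.obj b} {G : W} {S T : Fam P W}

/-- The morphism on bases of a morphism out of a free family. -/
def singleBase (α : single b p G ⟶ S) : b ⟶ S.base := α.base

/-- The image of the generator of a free family. -/
def singleGen (α : single b p G ⟶ S) (q : P.obj S.base) (h : P.map (singleBase α) p = q) :
    G ⟶ S.fib q :=
  Sigma.ι (fun _ : ULift.{w} (PLift (p = p)) => G) ⟨⟨rfl⟩⟩ ≫ α.app p q h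

/-- The morphism out of a free family given by the image of the generator. -/
def singleDesc (f : b ⟶ S.base) {q : P.obj S.base} (h : P.map f p = q) (g : G ⟶ S.fib q) :
    single b p G ⟶ S :=
  ⟨f, fun q' _ h' => Sigma.desc fun e => g ≫ eqToHom (by
    rw [← h, e.down.down]
    exact congrArg _ h')⟩

theorem singleGen_desc (f : b ⟶ S.base) {q : P.obj S.base} (h : P.map f p = q)
    (g : G ⟶ S.fib q) : singleGen (singleDesc f h g) q h = g :=
  (Sigma.ι_desc _ _).trans (Category.comp_id _)

theorem singleGen_comp (α : single b p G ⟶ S) (β : S ⟶ T) {q : P.obj S.base} {r : P.obj T.base}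
    (h₁ : P.map (singleBase α) p = q) (h₂ : P.map β.base q = r) (h) :
    singleGen (α ≫ β) r h = singleGen α q h₁ ≫ β.app q r h₂ :=
  (congrArg _ (comp_app α β h₁ h₂ h)).trans (Category.assoc _ _ _).symm

theorem singleGen_desc_comp (f : b ⟶ S.base) {q : P.obj S.base} (h₁ : P.map f p = q)
    (g : G ⟶ S.fib q) (β : S ⟶ T) {r : P.obj T.base} (h₂ : P.map β.base q = r) (h) :
    singleGen (singleDesc f h₁ g ≫ β) r h = g ≫ β.app q r h₂ :=
  (singleGen_comp _ β h₁ h₂ h).trans (congrArg (· ≫ β.app q r h₂) (singleGen_desc f h₁ g))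

theorem singleGen_congr {α β : single b p G ⟶ S} (e : α = β) (q h) :
    singleGen α q h = singleGen β q (e ▸ h) := by
  subst e
  rfl

/-- Away from `p` the members of the source are empty coproducts, so only the generator has to be
compared. -/
theorem single_hom_ext {α β : single b p G ⟶ S} (hb : singleBase α = singleBase β)
    (q : P.obj S.base) (hα : P.map (singleBase α) p = q) (hβ : P.map (singleBase β) p = q)
    (h : singleGen α q hα = singleGen β q hβ) : α = β :=
  hom_ext hb fun p' q' hα' hβ' => Sigma.hom_ext _ _ fun ⟨⟨e⟩⟩ => by
    subst e
    obtain rfl : q = q' := hα.symm.trans hα'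
    exact h

end

end Single

/-! ### Presentability of free families -/

section Presentable

variable {B : Type u₀} [Category.{w} B] {P : B ⥤ Type w} {W : Type u₁} [Category.{w} W]

section

variable {J : Type w} [SmallCategory J] {F : J ⥤ Fam P W} {c : Cocone F}

/-- Since `P` is accessible, the points of the colimit base are the colimit of the points of the
bases, so the fibre over `q` is indexed by elements of a `κ`-filtered diagram of sets over a point
of its colimit. -/
theorem isCardinalFiltered_fibIdx (hb : IsColimit ((forget P W).mapCocone c)) (κ : Cardinal.{w})
    [Fact κ.IsRegular] [P.IsCardinalAccessible κ] [IsCardinalFiltered J κ] (q : P.obj c.pt.base) :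
    IsCardinalFiltered (FibIdx F (b := c.pt.base) (fun j => (c.ι.app j).base) q) κ :=
  have := P.preservesColimitsOfShape_of_isCardinalAccessible κ J
  Elt.isCardinalFiltered (isColimitOfPreserves P hb) q κ

variable [HasCoproducts.{w} W] {b : B} {p : P.obj b} {G : W}

/-- The base map factors through a stage because `b` is presentable, and the generator through a
member of the fibre over `q` because `G` is. Filteredness of the fibre index category reconciles the
two choices. -/
theorem exists_hom_of_single (hb : IsColimit ((forget P W).mapCocone c))
    (hf : ∀ p, IsColimit (fibCocone c p)) (κ : Cardinal.{w}) [Fact κ.IsRegular]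
    [P.IsCardinalAccessible κ] [IsCardinalFiltered J κ] [IsCardinalPresentable b κ]
    [IsCardinalPresentable G κ] (α : single b p G ⟶ c.pt) :
    ∃ (j : J) (β : single b p G ⟶ F.obj j), β ≫ c.ι.app j = α := by
  obtain ⟨j, f, hj⟩ : ∃ (j : J) (f : b ⟶ (F.obj j).base),
      f ≫ (c.ι.app j).base = singleBase α :=
    IsCardinalPresentable.exists_hom_of_isColimit κ hb (singleBase α)
  let q : P.obj c.pt.base := P.map (singleBase α) p
  have := isCardinalFiltered_fibIdx hb κ q
  have := isFiltered_of_isCardinalFiltered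
    (FibIdx F (b := c.pt.base) (fun j => (c.ι.app j).base) q) κ
  obtain ⟨x, g, hg⟩ := IsCardinalPresentable.exists_hom_of_isColimit κ (hf q)
    (singleGen α q rfl)
  -- The stage chosen for the base, with the image of `p`, is itself an element over `q`. An upper
  -- bound of `x` and `y` therefore aligns both the stage and the point carrying the generator.
  let y : FibIdx F (b := c.pt.base) (fun j => (c.ι.app j).base) q :=
    ⟨j, P.map f p, (Functor.map_comp_apply P _ _ _).symm.trans
      (ConcreteCategory.congr_hom (congrArg P.map hj) p)⟩
  let z := IsFiltered.max x y
  let u : x ⟶ z := IsFiltered.leftToMax x y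
  let v : y ⟶ z := IsFiltered.rightToMax x y
  have hz : P.map (f ≫ (F.map v.1).base) p = z.val :=
    (Functor.map_comp_apply P _ _ _).trans v.2
  let β : single b p G ⟶ F.obj z.idx := singleDesc (S := F.obj z.idx) (f ≫ (F.map v.1).base) hz
    (g ≫ (fibDiag F (b := c.pt.base) (fun j => (c.ι.app j).base) q).map u)
  refine ⟨z.idx, β, single_hom_ext ?_ q ?_ rfl ?_⟩
  · refine (Category.assoc _ _ _).trans (Eq.trans ?_ hj)
    exact congrArg (f ≫ ·) (congrArg Hom.base (c.w v.1))
  · exact (Functor.map_comp_apply P _ _ _).trans ((congrArg _ hz).trans z.ι_val)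
  · refine (singleGen_desc_comp _ hz _ (c.ι.app z.idx) z.ι_val _).trans ?_
    exact (Category.assoc _ _ _).trans ((congrArg (g ≫ ·) ((fibCocone c q).w u)).trans hg)

/-- With equal bases both generators land in the same member `x` of the fibre diagram, and
presentability of `G` equalizes them along a morphism of fibre indices, which lies over a morphism
of `J`. -/
theorem exists_eq_of_single_of_base (hb : IsColimit ((forget P W).mapCocone c))
    (hf : ∀ p, IsColimit (fibCocone c p)) (κ : Cardinal.{w}) [Fact κ.IsRegular]
    [P.IsCardinalAccessible κ] [IsCardinalFiltered J κ] [IsCardinalPresentable G κ]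
    {j : J} (α β : single b p G ⟶ F.obj j)
    (e : singleBase α = singleBase β) (h : α ≫ c.ι.app j = β ≫ c.ι.app j) :
    ∃ (k : J) (u : j ⟶ k), α ≫ F.map u = β ≫ F.map u := by
  let q : P.obj c.pt.base := P.map (c.ι.app j).base (P.map (singleBase α) p)
  have := isCardinalFiltered_fibIdx hb κ q
  let x : FibIdx F (b := c.pt.base) (fun j => (c.ι.app j).base) q :=
    ⟨j, P.map (singleBase α) p, rfl⟩
  have hβ : P.map (singleBase β) p = x.val := by
    rw [← e]
  obtain ⟨y, v, hv⟩ := IsCardinalPresentable.exists_eq_of_isColimit' κ (hf q) (i := x)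
    (singleGen α x.val rfl) (singleGen β x.val hβ)
    ((singleGen_comp α (c.ι.app j) (r := q) rfl rfl (Functor.map_comp_apply P _ _ _)).symm.trans
      ((singleGen_congr h _ _).trans (singleGen_comp β (c.ι.app j) (q := x.val) hβ rfl _)))
  have hy {γ : single b p G ⟶ F.obj j} (hγ : P.map (singleBase γ) p = x.val) :
      P.map (singleBase (γ ≫ F.map v.1)) p = y.val :=
    (Functor.map_comp_apply P _ _ _).trans ((congrArg _ hγ).trans v.2)
  refine ⟨y.idx, v.1, single_hom_ext (congrArg (· ≫ (F.map v.1).base) e) y.val (hy rfl) (hy hβ) ?_⟩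
  exact (singleGen_comp α (F.map v.1) (q := x.val) rfl v.2 _).trans
    (hv.trans (singleGen_comp β (F.map v.1) (q := x.val) hβ v.2 _).symm)

theorem exists_eq_of_single (hb : IsColimit ((forget P W).mapCocone c))
    (hf : ∀ p, IsColimit (fibCocone c p)) (κ : Cardinal.{w}) [Fact κ.IsRegular]
    [P.IsCardinalAccessible κ] [IsCardinalFiltered J κ] [IsCardinalPresentable b κ]
    [IsCardinalPresentable G κ] {j : J} (α β : single b p G ⟶ F.obj j)
    (h : α ≫ c.ι.app j = β ≫ c.ι.app j) :
    ∃ (k : J) (u : j ⟶ k), α ≫ F.map u = β ≫ F.map u := by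
  obtain ⟨k, u, hu⟩ : ∃ (k : J) (u : j ⟶ k),
      singleBase α ≫ (F.map u).base = singleBase β ≫ (F.map u).base :=
    IsCardinalPresentable.exists_eq_of_isColimit' κ hb (singleBase α) (singleBase β)
      (congrArg singleBase h)
  obtain ⟨l, v, hv⟩ := exists_eq_of_single_of_base hb hf κ (α ≫ F.map u) (β ≫ F.map u) hu
    (by simpa using h)
  exact ⟨l, u ≫ v, by simpa using hv⟩

end

variable [HasColimitsOfSize.{w, w} B] [HasColimitsOfSize.{w, w} W]
  {κ : Cardinal.{w}} [Fact κ.IsRegular] [P.IsCardinalAccessible κ]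

/-- The two preceding existence lemmas are the surjectivity and injectivity halves of the criterion
for filtered colimits of sets. -/
theorem isCardinalPresentable_single (b : B) [IsCardinalPresentable b κ] (p : P.obj b) (G : W)
    [IsCardinalPresentable G κ] : IsCardinalPresentable (single b p G) κ where
  preservesColimitOfShape J _ _ := ⟨fun {F} =>
    have := isFiltered_of_isCardinalFiltered J κ
    preservesColimit_of_preserves_colimit_cocone (isColimitColimitCocone F)
      (Types.FilteredColimit.isColimitOf' _ _
        (fun α => by
          obtain ⟨j, β, h⟩ := exists_hom_of_single (isColimitForgetColimitCocone F)
            (isColimitFibColimitCocone F) κ α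
          exact ⟨j, β, h.symm⟩)
        fun _ α β h => exists_eq_of_single (isColimitForgetColimitCocone F)
            (isColimitFibColimitCocone F) κ α β h)⟩

end Presentable

/-! ### A strong generator of the category of families -/

section StrongGenerator

variable {B : Type u₀} [Category.{w} B] {P : B ⥤ Type w} {W : Type u₁} [Category.{w} W]
  [HasCoproducts.{w} W] [HasInitial W]

/-- The families freely generated by objects of `B` and `W` with given properties. -/
inductive generators (Q : ObjectProperty B) (R : ObjectProperty W) : ObjectProperty (Fam P W)
  -- These test the bases. The free families on a point cannot do so alone: none of them maps to a
  -- family whose index set is empty.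
  | free (b : B) (hb : Q b) : generators Q R ⟨b, fun _ => ⊥_ W⟩
  | single (b : B) (hb : Q b) (p : P.obj b) (G : W) (hG : R G) : generators Q R (single b p G)

variable {Q : ObjectProperty B} {R : ObjectProperty W}

instance [ObjectProperty.Small.{w} Q] [ObjectProperty.Small.{w} R] :
    ObjectProperty.Small.{w} (generators (P := P) Q R) := by
  let f : (Subtype Q) ⊕ ((b : Subtype Q) × P.obj b.1 × Subtype R) →
      Subtype (generators (P := P) Q R) :=
    Sum.elim (fun b => ⟨_, .free b.1 b.2⟩)
      (fun x => ⟨_, .single x.1.1 x.1.2 x.2.1 x.2.2.1 x.2.2.2⟩)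
  refine small_of_surjective (f := f) ?_
  rintro ⟨_, ⟨b, hb⟩ | ⟨b, hb, p, G, hG⟩⟩
  · exact ⟨Sum.inl ⟨b, hb⟩, rfl⟩
  · exact ⟨Sum.inr ⟨⟨b, hb⟩, p, ⟨G, hG⟩⟩, rfl⟩

/-- Initial families reduce statements about bases to `Q`. For the fibre over `p`, the hypothesis
`hP` pulls `p` back to a point `r` over a generating base `a`, and `single a r G` with `G` in `R`
then tests that member. -/
theorem isStrongGenerator_generators (hQ : Q.IsStrongGenerator) (hR : R.IsStrongGenerator)
    (hP : ∀ (b : B) (p : P.obj b), ∃ (a : B) (_ : Q a) (f : a ⟶ b) (q : P.obj a), P.map f q = p) :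
    (generators (P := P) Q R).IsStrongGenerator := by
  have sep_base {S T : Fam P W} {α β : S ⟶ T}
      (h : ∀ G, generators (P := P) Q R G → ∀ γ : G ⟶ S, γ ≫ α = γ ≫ β) : α.base = β.base :=
    hQ.isSeparating _ _ fun b hb f =>
      congrArg Hom.base (h _ (.free b hb) (freeHomEquiv b S |>.symm f))
  rw [ObjectProperty.isStrongGenerator_iff]
  refine ⟨fun S T α β h => hom_ext (sep_base h) fun p q hα hβ => ?_, fun S T i _ h => ?_⟩
  · refine hR.isSeparating _ _ fun G hG g => ?_
    obtain ⟨a, ha, f, r, hr⟩ := hP _ p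
    have key := singleGen_congr (h _ (.single a ha r G hG) (singleDesc f hr g)) q
      ((Functor.map_comp_apply P _ _ _).trans ((congrArg _ hr).trans hα))
    exact (singleGen_desc_comp f hr g α hα _).symm.trans
      (key.trans (singleGen_desc_comp f hr g β hβ _))
  -- Monicity is tested with all objects of `B` and `W`, not only with the generating ones. The
  -- lifting property is then needed only for generators.
  · have lift_base (a : B) (f g : a ⟶ S.base) (e : f ≫ i.base = g ≫ i.base) : f = g := by
      have : (freeHomEquiv a S).symm f = (freeHomEquiv a S).symm g := by
        rw [← cancel_mono i]
        exact hom_ext e fun _ _ _ _ => initial.hom_ext _ _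
      exact (freeHomEquiv a S).symm.injective this
    have : Mono i.base := ⟨fun f g e => lift_base _ f g e⟩
    have : IsIso i.base := hQ.isIso_of_mono _ fun b hb f => by
      obtain ⟨γ, hγ⟩ := h _ (.free b hb) ((freeHomEquiv b T).symm f)
      exact ⟨γ.base, congrArg Hom.base hγ⟩
    refine isIso_of_app i fun p q e => ?_
    have inj {G : W} (g g' : G ⟶ S.fib p) (e' : g ≫ i.app p q e = g' ≫ i.app p q e) : g = g' := by
      have h₁ : P.map (𝟙 S.base) p = p := by simp
      have hq : P.map (𝟙 S.base ≫ i.base) p = q :=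
        (Functor.map_comp_apply P _ _ _).trans ((congrArg _ h₁).trans e)
      have : singleDesc (S := S) (𝟙 _) h₁ g = singleDesc (S := S) (𝟙 _) h₁ g' := by
        rw [← cancel_mono i]
        exact single_hom_ext rfl q hq hq ((singleGen_desc_comp _ h₁ g i e _).trans
          (e'.trans (singleGen_desc_comp _ h₁ g' i e _).symm))
      have := singleGen_congr this p h₁
      rwa [singleGen_desc, singleGen_desc] at this
    have : Mono (i.app p q e) := ⟨inj⟩
    refine hR.isIso_of_mono _ fun G hG g => ?_
    obtain ⟨a, ha, f, r, hr⟩ := hP _ p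
    have hq : P.map (f ≫ i.base) r = q :=
      (Functor.map_comp_apply P _ _ _).trans ((congrArg _ hr).trans e)
    obtain ⟨γ, hγ⟩ := h _ (.single a ha r G hG) (singleDesc (S := T) (f ≫ i.base) hq g)
    replace hγ : γ ≫ i = singleDesc (S := T) (f ≫ i.base) hq g := hγ
    -- The lift `γ` covers `f` because `i.base` is a monomorphism; hence its generator lands in the
    -- member over `p` itself.
    have hγb : singleBase γ = f := (cancel_mono i.base).1 (congrArg singleBase hγ)
    have hγr : P.map (singleBase γ) r = p := by
      rw [hγb, hr]
    refine ⟨singleGen γ p hγr, ?_⟩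
    have key := singleGen_congr hγ q
      ((Functor.map_comp_apply P _ _ _).trans ((congrArg _ hγr).trans e))
    exact (singleGen_comp γ i hγr e _).symm.trans (key.trans (singleGen_desc _ hq g))

end StrongGenerator

/-- The category of families of objects of a locally `κ`-presentable category, indexed by a
`κ`-accessible functor on a locally `κ`-presentable category, is locally `κ`-presentable. -/
instance isCardinalLocallyPresentable {B : Type u₀} [Category.{w} B] (P : B ⥤ Type w) (W : Type u₁)
    [Category.{w} W] (κ : Cardinal.{w}) [Fact κ.IsRegular] [IsCardinalLocallyPresentable B κ]
    [IsCardinalLocallyPresentable W κ] [P.IsCardinalAccessible κ] :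
    IsCardinalLocallyPresentable (Fam P W) κ := by
  obtain ⟨Q, _, hQ⟩ := HasCardinalFilteredGenerator.exists_small_generator B κ
  obtain ⟨R, _, hR⟩ := HasCardinalFilteredGenerator.exists_small_generator W κ
  rw [IsCardinalLocallyPresentable.iff_exists_isStrongGenerator]
  refine ⟨generators Q R, inferInstance, isStrongGenerator_generators hQ.isStrongGenerator
    hR.isStrongGenerator fun b p => ?_, ?_⟩
  -- `P` preserves the `κ`-filtered colimit presenting `b` by objects of `Q`, so every point of `P
  -- b` comes from one of them.
  · obtain ⟨J, _, _, ⟨d⟩⟩ := hQ.exists_colimitsOfShape b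
    have := P.preservesColimitsOfShape_of_isCardinalAccessible κ J
    obtain ⟨j, q, hq⟩ := Types.jointly_surjective_of_isColimit
      (isColimitOfPreserves P d.isColimit) p
    exact ⟨_, d.prop_diag_obj j, d.ι.app j, q, hq⟩
  · rintro _ (⟨b, hb⟩ | ⟨b, hb, p, G, hG⟩)
    · have : IsCardinalPresentable b κ := hQ.le_isCardinalPresentable _ hb
      -- A left adjoint of a `κ`-accessible functor preserves `κ`-presentable objects.
      have : (forget P W).IsCardinalAccessible κ := ⟨fun J _ _ => inferInstance⟩
      exact (freeAdj P W).isCardinalPresentable_leftAdjoint_obj κ b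
    · have : IsCardinalPresentable b κ := hQ.le_isCardinalPresentable _ hb
      have : IsCardinalPresentable G κ := hR.le_isCardinalPresentable _ hG
      exact isCardinalPresentable_single b p G

end Fam


/-! ### Small powers of a category -/

namespace PiCategory

variable {I : Type w} {C : Type u} [Category.{w} C]

theorem hasColimitsOfSize_pi [HasColimitsOfSize.{w, w} C] : HasColimitsOfSize.{w, w} (I → C) where
  has_colimits_of_shape _ _ := ⟨fun _ => pi.hasColimit_of_hasColimit_comp_eval⟩

theorem preservesColimits_eval [HasColimitsOfSize.{w, w} C] (i : I) :
    PreservesColimitsOfSize.{w, w} (Pi.eval (fun _ : I => C) i) where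
  preservesColimitsOfShape :=
    ⟨fun {F} => preservesColimit_of_preserves_colimit_cocone
      (pi.coconeOfCoconeEvalIsColimit fun i => colimit.isColimit (F ⋙ Pi.eval _ i))
      (colimit.isColimit (F ⋙ Pi.eval _ i))⟩

attribute [local instance] hasColimitsOfSize_pi preservesColimits_eval

/-- A functor to a power preserves colimits if its components do. -/
theorem preservesColimits_of_eval {D : Type u₁} [Category.{v₁} D] (F : D ⥤ (I → C))
    (h : ∀ i, PreservesColimitsOfSize.{w, w} (F ⋙ Pi.eval (fun _ : I => C) i)) :
    PreservesColimitsOfSize.{w, w} F where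
  preservesColimitsOfShape := ⟨fun {K} => ⟨fun {c} hc => ⟨pi.coconeOfCoconeEvalIsColimit
    (F := K ⋙ F) (c := fun i => (F ⋙ Pi.eval (fun _ : I => C) i).mapCocone c) fun i =>
    isColimitOfPreserves (F ⋙ Pi.eval (fun _ : I => C) i) hc⟩⟩⟩

theorem isIso_of_isIso_app {S T : I → C} (α : S ⟶ T) (h : ∀ i, IsIso (α i)) : IsIso α :=
  ⟨fun i => inv (α i), funext fun i => IsIso.hom_inv_id (α i),
    funext fun i => IsIso.inv_hom_id (α i)⟩

section

variable [HasCoproducts.{w} C]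

/-- The family with the object `G` in degree `i` and the initial object in all other degrees. -/
def single (i : I) (G : C) : I → C := fun j => ∐ fun _ : ULift.{w} (PLift (i = j)) => G

/-- A morphism out of `single i G` is a morphism out of `G`. -/
def singleHomEquiv (i : I) (G : C) (S : I → C) : (single i G ⟶ S) ≃ (G ⟶ S i) where
  toFun α := Sigma.ι (fun _ : ULift.{w} (PLift (i = i)) => G) ⟨⟨rfl⟩⟩ ≫ α i
  invFun g j := Sigma.desc fun e => g ≫ eqToHom (by rw [e.down.down])
  left_inv α := by
    funext j
    refine Sigma.hom_ext _ _ fun ⟨⟨e⟩⟩ => ?_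
    subst e
    exact (Sigma.ι_desc _ _).trans (Category.comp_id _)
  right_inv g := (Sigma.ι_desc _ _).trans (Category.comp_id _)

theorem singleHomEquiv_comp {i : I} {G : C} {S T : I → C} (α : single i G ⟶ S) (β : S ⟶ T) :
    singleHomEquiv i G T (α ≫ β) = singleHomEquiv i G S α ≫ β i :=
  (Category.assoc _ _ _).symm

/-- The left adjoint of an evaluation functor. -/
def singleFunctor (i : I) : C ⥤ (I → C) :=
  Adjunction.leftAdjointOfEquiv (G := Pi.eval (fun _ : I => C) i) (singleHomEquiv i)
    fun _ _ _ g h => singleHomEquiv_comp h g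

/-- The functor `singleFunctor i` is left adjoint to evaluation at `i`. -/
def singleAdj (i : I) : singleFunctor i ⊣ Pi.eval (fun _ : I => C) i :=
  Adjunction.adjunctionOfEquivLeft _ _

/-- Maps out of `single i G` see only degree `i`, so separation, monicity and lifting are all
checked one degree at a time. -/
theorem isStrongGenerator_single {R : ObjectProperty C} (hR : R.IsStrongGenerator) :
    (ObjectProperty.ofObj fun x : I × Subtype R => single x.1 x.2.1).IsStrongGenerator := by
  rw [ObjectProperty.isStrongGenerator_iff]
  refine ⟨fun S T α β h => funext fun i => hR.isSeparating _ _ fun G hG g => ?_,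
    fun S T α _ h => isIso_of_isIso_app α fun i => ?_⟩
  · have := congrArg (singleHomEquiv i G T) (h _ ⟨(i, ⟨G, hG⟩)⟩ ((singleHomEquiv i G S).symm g))
    simpa [singleHomEquiv_comp] using this
  · have : Mono (α i) := ⟨fun {G} g g' e => (singleHomEquiv i G S).symm.injective (by
      rw [← cancel_mono α]
      apply (singleHomEquiv i G T).injective
      simpa [singleHomEquiv_comp] using e)⟩
    refine hR.isIso_of_mono _ fun G hG g => ?_
    obtain ⟨γ, hγ⟩ := h _ ⟨(i, ⟨G, hG⟩)⟩ ((singleHomEquiv i G T).symm g)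
    refine ⟨singleHomEquiv i G S γ, ?_⟩
    exact (singleHomEquiv_comp γ α).symm.trans
      ((congrArg _ hγ).trans ((singleHomEquiv i G T).apply_symm_apply g))

end

/-- A small power of a locally `κ`-presentable category is locally `κ`-presentable. -/
theorem isCardinalLocallyPresentable_pi (κ : Cardinal.{w}) [Fact κ.IsRegular]
    [IsCardinalLocallyPresentable C κ] : IsCardinalLocallyPresentable (I → C) κ := by
  obtain ⟨R, _, hR, hR'⟩ :=
    (IsCardinalLocallyPresentable.iff_exists_isStrongGenerator C κ).1 inferInstance
  rw [IsCardinalLocallyPresentable.iff_exists_isStrongGenerator]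
  refine ⟨_, inferInstance, isStrongGenerator_single hR, ?_⟩
  rintro _ ⟨i, G, hG⟩
  have : IsCardinalPresentable G κ := hR' _ hG
  have : (Pi.eval (fun _ : I => C) i).IsCardinalAccessible κ := ⟨fun J _ _ => inferInstance⟩
  exact (singleAdj i).isCardinalPresentable_leftAdjoint_obj κ G

/-! ### Matrices of functors acting on powers -/

section Sum

variable {J : Type w} [HasCoproducts.{w} C] (T : J → I → C ⥤ C)

/-- The functor between powers given by a matrix of functors. -/
def matrixFunctor : (J → C) ⥤ (I → C) where
  obj N i := ∐ fun j => (T j i).obj (N j)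
  map a i := Limits.Sigma.map fun j => (T j i).map (a j)
  map_id N := funext fun i => Sigma.hom_ext _ _ fun j => by simp
  map_comp a b := funext fun i => Sigma.hom_ext _ _ fun j => by simp

end Sum

/-- Each degree is a coproduct of the cocontinuous functors `N ↦ (T j i).obj (N j)`, and coproducts
commute with colimits. -/
theorem preservesColimits_matrixFunctor [HasColimitsOfSize.{w, w} C] {J : Type w}
    (T : J → I → C ⥤ C) (h : ∀ j i, PreservesColimitsOfSize.{w, w} (T j i)) :
    PreservesColimitsOfSize.{w, w} (matrixFunctor T) := by
  refine preservesColimits_of_eval _ fun i => ⟨⟨fun {K} => ⟨fun {c} hc => ?_⟩⟩⟩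
  have hj (j : J) : IsColimit ((Pi.eval (fun _ : J => C) j ⋙ T j i).mapCocone c) :=
    isColimitOfPreserves _ hc
  -- A cocone on the coproducts is restricted to its `j`-th summands, where the universal property
  -- of `hj j` is available.
  let t (s : Cocone (K ⋙ matrixFunctor T ⋙ Pi.eval (fun _ : I => C) i)) (j : J) :
      Cocone (K ⋙ Pi.eval (fun _ : J => C) j ⋙ T j i) :=
    { pt := s.pt
      ι :=
        { app k := Sigma.ι (fun j => (T j i).obj (K.obj k j)) j ≫ s.ι.app k
          naturality k l f := by
            have e : Sigma.ι (fun j => (T j i).obj (K.obj k j)) j ≫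
                Limits.Sigma.map (fun j => (T j i).map (K.map f j)) =
                (T j i).map (K.map f j) ≫ Sigma.ι (fun j => (T j i).obj (K.obj l j)) j := by
              simp
            refine Eq.trans ?_ (Category.comp_id _).symm
            exact (Category.assoc _ _ _).symm.trans ((congrArg (· ≫ s.ι.app l) e.symm).trans
              ((Category.assoc _ _ _).trans (congrArg _ (s.w f)))) } }
  have hι (k) (j : J) : Sigma.ι (fun j => (T j i).obj (K.obj k j)) j ≫
      Limits.Sigma.map (fun j => (T j i).map (c.ι.app k j)) =
      (T j i).map (c.ι.app k j) ≫ Sigma.ι (fun j => (T j i).obj (c.pt j)) j := by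
    simp
  exact ⟨
    { desc s := Sigma.desc fun j => (hj j).desc (t s j)
      fac s k := Sigma.hom_ext _ _ fun j => by
        refine (Category.assoc _ _ _).symm.trans ((congrArg (· ≫ _) (hι k j)).trans ?_)
        refine (Category.assoc _ _ _).trans ((congrArg _ (Sigma.ι_desc _ _)).trans ?_)
        exact (hj j).fac (t s j) k
      uniq s m hm := Sigma.hom_ext _ _ fun j => (hj j).hom_ext fun k => by
        have e : Sigma.ι (fun j => (T j i).obj (c.pt j)) j ≫
            Limits.Sigma.desc (fun j => (hj j).desc (t s j)) = (hj j).desc (t s j) :=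
          Sigma.ι_desc _ _
        refine Eq.trans ?_ (congrArg (fun f => (T j i).map (c.ι.app k j) ≫ f) e.symm)
        refine Eq.trans ?_ ((hj j).fac (t s j) k).symm
        refine (Category.assoc _ _ _).symm.trans ((congrArg (· ≫ m) (hι k j).symm).trans ?_)
        exact (Category.assoc _ _ _).trans (congrArg _ (hm k)) }⟩

/-! ### Pairs of sets and their product -/

section Pair

/-- The functor sending a pair of types to their product. -/
def pairProd : (ULift.{w} Bool → Type w) ⥤ Type w where
  -- Pairs are a `Bool`-indexed power, so the results on powers apply to them; `true` holds the row
  -- indices (target) and `false` the column indices (source).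
  obj b := b ⟨true⟩ × b ⟨false⟩
  map f := TypeCat.ofHom fun p => (f ⟨true⟩ p.1, f ⟨false⟩ p.2)

/-- Filtered colimits of sets commute with binary products: representatives, and witnesses of
equality, in the two coordinates are moved to a common stage. -/
theorem isCardinalAccessible_pairProd (κ : Cardinal.{w}) [Fact κ.IsRegular] :
    pairProd.{w}.IsCardinalAccessible κ where
  preservesColimitOfShape J _ _ := ⟨fun {K} => ⟨fun {c} hc => by
    have := isFiltered_of_isCardinalFiltered J κ
    have hi (i : ULift.{w} Bool) : IsColimit ((Pi.eval (fun _ => Type w) i).mapCocone c) :=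
      isColimitOfPreserves _ hc
    refine ⟨Types.FilteredColimit.isColimitOf' _ _ ?_ ?_⟩
    · rintro ⟨y, x⟩
      obtain ⟨j, y', rfl⟩ := Types.jointly_surjective_of_isColimit (hi ⟨true⟩) y
      obtain ⟨k, x', rfl⟩ := Types.jointly_surjective_of_isColimit (hi ⟨false⟩) x
      refine ⟨IsFiltered.max j k, (K.map (IsFiltered.leftToMax j k) ⟨true⟩ y',
        K.map (IsFiltered.rightToMax j k) ⟨false⟩ x'), Prod.ext ?_ ?_⟩
      · exact (ConcreteCategory.congr_hom
          (congrFun (c.w (IsFiltered.leftToMax j k)) ⟨true⟩) y').symm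
      · exact (ConcreteCategory.congr_hom
          (congrFun (c.w (IsFiltered.rightToMax j k)) ⟨false⟩) x').symm
    · rintro j ⟨y, x⟩ ⟨y', x'⟩ h
      obtain ⟨k, f, hf⟩ := (Types.FilteredColimit.isColimit_eq_iff' (hi ⟨true⟩) y y').1
        (congrArg Prod.fst h)
      obtain ⟨l, g, hg⟩ := (Types.FilteredColimit.isColimit_eq_iff' (hi ⟨false⟩) x x').1
        (congrArg Prod.snd h)
      -- The equality `f ≫ u = g ≫ v` makes a single morphism of `J` work for both coordinates.
      obtain ⟨m, u, v, e⟩ := IsFiltered.span f g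
      refine ⟨m, f ≫ u, Prod.ext ?_ ?_⟩
      · have (a : K.obj j ⟨true⟩) :
            K.map (f ≫ u) ⟨true⟩ a = K.map u ⟨true⟩ (K.map f ⟨true⟩ a) :=
          ConcreteCategory.congr_hom (congrFun (K.map_comp f u) ⟨true⟩) a
        exact (this y).trans ((congrArg (K.map u ⟨true⟩) hf).trans (this y').symm)
      · have (a : K.obj j ⟨false⟩) :
            K.map (f ≫ u) ⟨false⟩ a = K.map v ⟨false⟩ (K.map g ⟨false⟩ a) := by
          rw [e]
          exact ConcreteCategory.congr_hom (congrFun (K.map_comp g v) ⟨false⟩) a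
        exact (this x).trans ((congrArg (K.map v ⟨false⟩) hg).trans (this x').symm)⟩⟩

end Pair

end PiCategory

/-! ### Transport along equivalences -/

section Transport

variable {A : Type u} [Category.{v} A] {B : Type u₀} [Category.{v₀} B] {C : Type u₁}
  [Category.{v₁} C] (E : A ⥤ B) [E.IsEquivalence] (F : B ⥤ C)

/-- A functor is recovered from its restriction along an equivalence. -/
def invCompCompIso : E.inv ⋙ E ⋙ F ≅ F :=
  (Functor.associator _ _ _).symm ≪≫ Functor.isoWhiskerRight E.asEquivalence.counitIso F ≪≫
    F.leftUnitor

theorem preservesColimits_of_equivalence_comp [PreservesColimitsOfSize.{w, w} (E ⋙ F)] :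
    PreservesColimitsOfSize.{w, w} F :=
  preservesColimits_of_natIso (invCompCompIso E F)

theorem isRightAdjoint_of_equivalence_comp [(E ⋙ F).IsRightAdjoint] : F.IsRightAdjoint :=
  Functor.isRightAdjoint_of_iso (invCompCompIso E F)

end Transport

namespace VMat

/-! ### Companions and conjoints -/

section Fibrant

attribute [local instance] hasInitial_of_hasCoproducts

variable {V : Type u} [Category.{w} V] [MonoidalCategory V] [HasCoproducts.{w} V]
  [∀ (A : V) (J : Type w), PreservesColimitsOfShape (Discrete J) (tensorLeft A)]
  [∀ (A : V) (J : Type w), PreservesColimitsOfShape (Discrete J) (tensorRight A)]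

/-- The companion of a function. -/
abbrev companion {X Y : Type w} (f : X → Y) : Mat V X Y := fun y x => unit Y y (f x)

/-- The conjoint of a function. -/
abbrev conjoint {X Y : Type w} (f : X → Y) : Mat V Y X := fun x y => unit Y (f x) y

/-- Both unit matrices are tested on their copies of `I`, the entries off the diagonal being
initial. After interchanging the two insertions of `I`, naturality of the unitors leaves `λ_ I = ρ_
I`. -/
theorem companion_hcomp {X Y : Type w} (f : X → Y) (y : Y) (x : X) :
    compApp (M := companion (V := V) f) (N := unit X) (M' := unit Y) (N' := companion f)
      (g := fun y => y) (f := f) (e := fun x => x) (fun y x => 𝟙 (unit Y y (f x)))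
      (unitApp f) y x ≫ leftUnitorHom (companion f) y x =
    rightUnitorHom (companion f) y x := by
  refine rightUnitor_ext _ ?_
  have h₁ : companion (V := V) f y x ◁ idι x ≫ (𝟙 (unit Y y (f x)) ⊗ₘ unitApp f x x) =
      unit Y y (f x) ◁ idι (f x) := by
    rw [id_tensorHom, ← whiskerLeft_comp, idι_unitApp]
  rw [ι_compApp_assoc, ι_rightUnitorHom, reassoc_of% h₁]
  refine unit_hom_extR (p := f x = y) fun h => ?_
  subst h
  have h₃ : idι (V := V) (f x) ▷ unit Y (f x) (f x) ≫
      compι (unit Y) (companion f) (f x) (f x) x ≫ leftUnitorHom (companion f) (f x) x =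
      (λ_ (unit Y (f x) (f x))).hom := ι_leftUnitorHom (companion f) (f x) x
  have h₂ : idι (V := V) (f x) ▷ 𝟙_ V ≫ unit Y (f x) (f x) ◁ idι (f x) ≫
      compι (unit Y) (companion f) (f x) (f x) x ≫ leftUnitorHom (companion f) (f x) x =
      idι (f x) ▷ 𝟙_ V ≫ (ρ_ (unit Y (f x) (f x))).hom := by
    rw [← whisker_exchange_assoc, h₃, leftUnitor_naturality,
      rightUnitor_naturality, unitors_equal]
  exact h₂

theorem conjoint_hcomp {X Y : Type w} (f : X → Y) (x : X) (y : Y) :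
    compApp (M := unit (V := V) X) (N := conjoint f) (M' := conjoint f) (N' := unit Y)
      (g := fun x => x) (f := f) (e := fun y => y) (unitApp f)
      (fun x y => 𝟙 (unit Y (f x) y)) x y ≫ rightUnitorHom (conjoint f) x y =
    leftUnitorHom (conjoint f) x y := by
  refine leftUnitor_ext _ ?_
  have h₁ : idι (V := V) x ▷ conjoint f x y ≫ (unitApp f x x ⊗ₘ 𝟙 (unit Y (f x) y)) =
      idι (f x) ▷ unit Y (f x) y := by
    rw [tensorHom_id, ← comp_whiskerRight, idι_unitApp]
  rw [ι_compApp_assoc, ι_leftUnitorHom, reassoc_of% h₁]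
  refine unit_hom_extL (p := y = f x) fun h => ?_
  subst h
  have h₃ : unit Y (f x) (f x) ◁ idι (V := V) (f x) ≫
      compι (conjoint f) (unit Y) x (f x) (f x) ≫ rightUnitorHom (conjoint f) x (f x) =
      (ρ_ (unit Y (f x) (f x))).hom := ι_rightUnitorHom (conjoint f) x (f x)
  have h₂ : 𝟙_ V ◁ idι (V := V) (f x) ≫ idι (f x) ▷ unit Y (f x) (f x) ≫
      compι (conjoint f) (unit Y) x (f x) (f x) ≫ rightUnitorHom (conjoint f) x (f x) =
      𝟙_ V ◁ idι (f x) ≫ (λ_ (unit Y (f x) (f x))).hom := by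
    rw [whisker_exchange_assoc, h₃, leftUnitor_naturality,
      rightUnitor_naturality, unitors_equal]
  exact h₂

theorem isFibrant_vMat : (vMat.{w} V).IsFibrant := fun (X Y : Type w) (f : X ⟶ Y) =>
  ⟨⟨{ hor := companion f
      p₁ := Cell.mk (S := ⟨X, Y, companion f⟩) (T := ⟨Y, Y, unit Y⟩) f (𝟙 Y)
        fun y x => 𝟙 (unit Y y (f x))
      p₂ := Cell.mk (S := ⟨X, X, unit X⟩) (T := ⟨X, Y, companion f⟩) (𝟙 X) f (unitApp f)
      srcMap_p₁ := rfl
      tgtMap_p₁ := rfl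
      srcMap_p₂ := rfl
      tgtMap_p₂ := rfl
      p₂_comp_p₁ := Cell.mk_ext fun _ _ => Category.comp_id _
      p₁_hcomp_p₂ :=
        (congrArg (· ≫ (globularIso (leftUnitorIso (companion f))).hom) (compMap_mk _ _)).trans
          (Cell.mk_ext (companion_hcomp f)) }⟩,
    ⟨{ hor := conjoint f
       q₁ := Cell.mk (S := ⟨Y, X, conjoint f⟩) (T := ⟨Y, Y, unit Y⟩) (𝟙 Y) f
         fun x y => 𝟙 (unit Y (f x) y)
       q₂ := Cell.mk (S := ⟨X, X, unit X⟩) (T := ⟨Y, X, conjoint f⟩) f (𝟙 X) (unitApp f)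
       srcMap_q₁ := rfl
       tgtMap_q₁ := rfl
       srcMap_q₂ := rfl
       tgtMap_q₂ := rfl
       q₂_comp_q₁ := Cell.mk_ext fun _ _ => Category.comp_id _
       q₂_hcomp_q₁ :=
        (congrArg (· ≫ (globularIso (rightUnitorIso (conjoint f))).hom) (compMap_mk _ _)).trans
          (Cell.mk_ext (conjoint_hcomp f)) }⟩⟩

end Fibrant

/-! ### Categories of matrices as categories of families -/

section Arrows

variable {V : Type u} [Category.{w} V]

theorem cell_app_inj {S T : HArrow (Mat.{w} V)} {l : S.src ⟶ T.src} {r : S.tgt ⟶ T.tgt}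
    {a b : ∀ (y : S.tgt) (x : S.src), S.hom y x ⟶ T.hom (r y) (l x)}
    (h : Cell.mk l r a = Cell.mk l r b) (y x) : a y x = b y x := by
  cases h
  rfl

variable (V) in
/-- Matrices as families indexed by products of pairs of types. -/
def ofPairs : Fam PiCategory.pairProd.{w} V ⥤ HArrow (Mat.{w} V) where
  obj S := ⟨S.base ⟨false⟩, S.base ⟨true⟩, fun y x => S.fib (y, x)⟩
  map {S T} α := Cell.mk (S := ⟨S.base ⟨false⟩, S.base ⟨true⟩, fun y x => S.fib (y, x)⟩)
    (T := ⟨T.base ⟨false⟩, T.base ⟨true⟩, fun y x => T.fib (y, x)⟩)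
    (α.base ⟨false⟩) (α.base ⟨true⟩) fun y x => α.app (y, x) _ rfl

instance : (ofPairs V).Faithful where
  map_injective {S T α β} h := by
    obtain ⟨f, a⟩ := α
    obtain ⟨g, b⟩ := β
    obtain rfl : f = g := by
      funext ⟨i⟩
      cases i
      · exact congrArg Cell.left h
      · exact congrArg Cell.right h
    refine Fam.hom_ext rfl fun p q hα _ => ?_
    subst hα
    exact cell_app_inj h p.1 p.2

instance : (ofPairs V).Full where
  map_surjective := by
    rintro S T ⟨l, r, a⟩
    refine ⟨⟨fun i => match i with | ⟨true⟩ => r | ⟨false⟩ => l,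
      fun p q h => a p.1 p.2 ≫ eqToHom (by rw [← h]; rfl)⟩, ?_⟩
    exact Cell.mk_ext fun y x => Category.comp_id _

instance : (ofPairs V).IsEquivalence where
  essSurj := ⟨fun M => ⟨⟨fun i => match i with | ⟨true⟩ => M.tgt | ⟨false⟩ => M.src,
    fun p => M.hom p.1 p.2⟩, ⟨Iso.refl _⟩⟩⟩

end Arrows

section Families

variable {V : Type u} [Category.{w} V] [MonoidalCategory V] [HasCoproducts.{w} V]
  [∀ (A : V) (J : Type w), PreservesColimitsOfShape (Discrete J) (tensorLeft A)]
  [∀ (A : V) (J : Type w), PreservesColimitsOfShape (Discrete J) (tensorRight A)]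

variable (V) in
/-- The category of matrices with domain `X`. -/
def FixedSrc (X : Type w) : Type (max u (w + 1)) := PseudoDoubleCategory.FixedSrc (vMat.{w} V) X

instance (X : Type w) : Category.{w} (FixedSrc V X) :=
  PseudoDoubleCategory.instCategoryFixedSrc (vMat.{w} V) X

variable (V) in
/-- The category of matrices with codomain `Y`. -/
def FixedTgt (Y : Type w) : Type (max u (w + 1)) := PseudoDoubleCategory.FixedTgt (vMat.{w} V) Y

instance (Y : Type w) : Category.{w} (FixedTgt V Y) :=
  PseudoDoubleCategory.instCategoryFixedTgt (vMat.{w} V) Y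

variable (V) in
/-- Matrices with a fixed domain as families of rows. -/
def ofRows (X : Type w) : Fam (𝟭 (Type w)) (X → V) ⥤ FixedSrc V X where
  obj S := ⟨S.base, fun y x => S.fib y x⟩
  map {S T} α := ⟨Cell.mk (S := ⟨X, S.base, fun y x => S.fib y x⟩)
    (T := ⟨X, T.base, fun y x => T.fib y x⟩) (𝟙 X) α.base fun y x => α.app y _ rfl x, rfl⟩

instance (X : Type w) : (ofRows V X).Faithful where
  map_injective {S T α β} h := by
    replace h := congrArg Subtype.val h
    obtain ⟨f, a⟩ := α
    obtain ⟨g, b⟩ := β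
    obtain rfl : f = g := congrArg Cell.right h
    refine Fam.hom_ext rfl fun y q hα _ => ?_
    subst hα
    funext x
    exact cell_app_inj h y x

instance (X : Type w) : (ofRows V X).Full where
  map_surjective := by
    rintro S T ⟨⟨l, r, a⟩, h⟩
    obtain rfl : l = 𝟙 X := h
    refine ⟨⟨r, fun y q h x => a y x ≫ eqToHom (by rw [← h]; rfl)⟩, Subtype.ext ?_⟩
    exact Cell.mk_ext fun y x => Category.comp_id _

instance (X : Type w) : (ofRows V X).IsEquivalence where
  essSurj := ⟨fun M => ⟨⟨M.tgt, M.hor⟩, ⟨Iso.refl _⟩⟩⟩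

variable (V) in
/-- Matrices with a fixed codomain as families of columns. -/
def ofColumns (Y : Type w) : Fam (𝟭 (Type w)) (Y → V) ⥤ FixedTgt V Y where
  obj S := ⟨S.base, fun y x => S.fib x y⟩
  map {S T} α := ⟨Cell.mk (S := ⟨S.base, Y, fun y x => S.fib x y⟩)
    (T := ⟨T.base, Y, fun y x => T.fib x y⟩) α.base (𝟙 Y) fun y x => α.app x _ rfl y, rfl⟩

instance (Y : Type w) : (ofColumns V Y).Faithful where
  map_injective {S T α β} h := by
    replace h := congrArg Subtype.val h
    obtain ⟨f, a⟩ := α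
    obtain ⟨g, b⟩ := β
    obtain rfl : f = g := congrArg Cell.left h
    refine Fam.hom_ext rfl fun x q hα _ => ?_
    subst hα
    funext y
    exact cell_app_inj h y x

instance (Y : Type w) : (ofColumns V Y).Full where
  map_surjective := by
    rintro S T ⟨⟨l, r, a⟩, h⟩
    obtain rfl : r = 𝟙 Y := h
    refine ⟨⟨l, fun x q h y => a y x ≫ eqToHom (by rw [← h]; rfl)⟩, Subtype.ext ?_⟩
    exact Cell.mk_ext fun y x => Category.comp_id _

instance (Y : Type w) : (ofColumns V Y).IsEquivalence where
  essSurj := ⟨fun M => ⟨⟨M.src, fun x y => M.hor y x⟩, ⟨Iso.refl _⟩⟩⟩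

end Families

/-! ### Composition with a fixed matrix as a sum of tensorings -/

section Sums

variable {V : Type u} [Category.{w} V] [MonoidalCategory V] [HasCoproducts.{w} V]

/-- This matches the action of `matrixFunctor` on morphisms with horizontal composition by an
identity 2-morphism; it is the naturality of `ofRowsCompPrecomp`. -/
theorem sigmaMap_whiskerRight {X Y Z Z' : Type w} {N : Mat V Y Z} {N' : Mat V Y Z'} {g : Z → Z'}
    (a : ∀ z y, N z y ⟶ N' (g z) y) (M : Mat V X Y) (z : Z) (x : X) :
    Limits.Sigma.map (fun y => a z y ▷ M y x) =
      compApp (g := g) (f := fun y => y) (e := fun x => x) a (fun y x => 𝟙 (M y x)) z x :=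
  comp_hom_ext fun y => by
    have h := ι_compApp (g := g) (f := fun y => y) (e := fun x => x) a (fun y x => 𝟙 (M y x)) z y x
    rw [tensorHom_id] at h
    exact (Sigma.ι_map _ _).trans h.symm

theorem sigmaMap_whiskerLeft {X Y Z Z' : Type w} (M : Mat V X Y) {N : Mat V Z X} {N' : Mat V Z' X}
    {g : Z → Z'} (a : ∀ x z, N x z ⟶ N' x (g z)) (y : Y) (z : Z) :
    Limits.Sigma.map (fun x => M y x ◁ a x z) =
      compApp (g := fun y => y) (f := fun x => x) (e := g) (fun y x => 𝟙 (M y x)) a y z :=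
  comp_hom_ext fun x => by
    have h := ι_compApp (g := fun y => y) (f := fun x => x) (e := g) (fun y x => 𝟙 (M y x)) a y x z
    rw [id_tensorHom] at h
    exact (Sigma.ι_map _ _).trans h.symm

end Sums

-- Cocontinuity, adjoints and local presentability for matrices

attribute [local instance] PiCategory.hasColimitsOfSize_pi PiCategory.preservesColimits_eval
  PiCategory.isCardinalLocallyPresentable_pi PiCategory.isCardinalAccessible_pairProd
  hasInitial_of_hasCoproducts

/-- The left adjoint puts a set in coordinate `i` and the empty set in the other one, then takes the
family of initial objects over this pair. The product being empty, this is the empty matrix. -/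
theorem isRightAdjoint_forget_eval (V : Type u) [Category.{w} V] [HasCoproducts.{w} V]
    (i : ULift.{w} Bool) :
    (Fam.forget PiCategory.pairProd.{w} V ⋙ Pi.eval (fun _ => Type w) i).IsRightAdjoint :=
  ((PiCategory.singleAdj i).comp (Fam.freeAdj PiCategory.pairProd.{w} V)).isRightAdjoint

theorem isCardinalAccessible_id (κ : Cardinal.{w}) [Fact κ.IsRegular] :
    (𝟭 (Type w)).IsCardinalAccessible κ :=
  ⟨fun _ _ _ => inferInstance⟩

attribute [local instance] isCardinalAccessible_id

section Cocontinuous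

variable {V : Type u} [Category.{w} V] [MonoidalCategory V] [HasColimitsOfSize.{w, w} V]
  [∀ A : V, PreservesColimitsOfSize.{w, w} (tensorLeft A)]
  [∀ A : V, PreservesColimitsOfSize.{w, w} (tensorRight A)]

/-- The functor `- ⊙ M`. -/
def precomp {X Y : Type w} (M : Mat V X Y) : FixedSrc V Y ⥤ FixedSrc V X :=
  PseudoDoubleCategory.precomp (vMat.{w} V) M

/-- The functor `M ⊙ -`. -/
def postcomp {X Y : Type w} (M : Mat V X Y) : FixedTgt V X ⥤ FixedTgt V Y :=
  PseudoDoubleCategory.postcomp (vMat.{w} V) M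

/-- Composition with a matrix acts on the rows of a matrix. -/
def ofRowsCompPrecomp {X Y : Type w} (M : Mat V X Y) :
    Fam.map (𝟭 (Type w)) (PiCategory.matrixFunctor fun y x => tensorRight (M y x)) ⋙ ofRows V X ≅
      ofRows V Y ⋙ precomp M :=
  -- On objects the two functors agree definitionally, both giving the coproducts of `N z y ⊗ M y
  -- x`; only the action on morphisms needs an argument.
  NatIso.ofComponents (fun _ => Iso.refl _) fun {S T} α => by
    refine (Category.comp_id _).trans (Eq.trans ?_ (Category.id_comp _).symm)
    refine Subtype.ext (Eq.trans ?_ (compMap_mk _ _).symm)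
    exact Cell.mk_ext fun z x => sigmaMap_whiskerRight (fun z y => α.app z _ rfl y) M z x

theorem preservesColimits_precomp {X Y : Type w} (M : Mat V X Y) :
    PreservesColimitsOfSize.{w, w} (precomp M) := by
  have := PiCategory.preservesColimits_matrixFunctor (fun y x => tensorRight (M y x))
    fun _ _ => inferInstance
  have := preservesColimits_of_natIso (ofRowsCompPrecomp M)
  exact preservesColimits_of_equivalence_comp (ofRows V Y) _

/-- Composition with a matrix acts on the columns of a matrix. -/
def ofColumnsCompPostcomp {X Y : Type w} (M : Mat V X Y) :
    Fam.map (𝟭 (Type w)) (PiCategory.matrixFunctor fun x y => tensorLeft (M y x)) ⋙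
      ofColumns V Y ≅ ofColumns V X ⋙ postcomp M :=
  NatIso.ofComponents (fun _ => Iso.refl _) fun {S T} α => by
    refine (Category.comp_id _).trans (Eq.trans ?_ (Category.id_comp _).symm)
    refine Subtype.ext (Eq.trans ?_ (compMap_mk _ _).symm)
    exact Cell.mk_ext fun y z => sigmaMap_whiskerLeft M (N := fun x z => S.fib z x)
      (N' := fun x z => T.fib z x) (g := α.base) (fun x z => α.app z _ rfl x) y z

theorem preservesColimits_postcomp {X Y : Type w} (M : Mat V X Y) :
    PreservesColimitsOfSize.{w, w} (postcomp M) := by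
  have := PiCategory.preservesColimits_matrixFunctor (fun x y => tensorLeft (M y x))
    fun _ _ => inferInstance
  have := preservesColimits_of_natIso (ofColumnsCompPostcomp M)
  exact preservesColimits_of_equivalence_comp (ofColumns V X) _

theorem preservesColimits_src : PreservesColimitsOfSize.{w, w} (vMat.{w} V).src := by
  have : PreservesColimitsOfSize.{w, w} (ofPairs V ⋙ (vMat.{w} V).src) :=
    inferInstanceAs (PreservesColimitsOfSize.{w, w}
      (Fam.forget PiCategory.pairProd.{w} V ⋙ Pi.eval (fun _ => Type w) ⟨false⟩))
  exact preservesColimits_of_equivalence_comp (ofPairs V) _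

theorem preservesColimits_tgt : PreservesColimitsOfSize.{w, w} (vMat.{w} V).tgt := by
  have : PreservesColimitsOfSize.{w, w} (ofPairs V ⋙ (vMat.{w} V).tgt) :=
    inferInstanceAs (PreservesColimitsOfSize.{w, w}
      (Fam.forget PiCategory.pairProd.{w} V ⋙ Pi.eval (fun _ => Type w) ⟨true⟩))
  exact preservesColimits_of_equivalence_comp (ofPairs V) _

theorem isRightAdjoint_src : (vMat.{w} V).src.IsRightAdjoint := by
  have : (ofPairs V ⋙ (vMat.{w} V).src).IsRightAdjoint := isRightAdjoint_forget_eval V ⟨false⟩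
  exact isRightAdjoint_of_equivalence_comp (ofPairs V) _

theorem isRightAdjoint_tgt : (vMat.{w} V).tgt.IsRightAdjoint := by
  have : (ofPairs V ⋙ (vMat.{w} V).tgt).IsRightAdjoint := isRightAdjoint_forget_eval V ⟨true⟩
  exact isRightAdjoint_of_equivalence_comp (ofPairs V) _

end Cocontinuous

section LocallyPresentable

variable {V : Type u} [Category.{w} V] [MonoidalCategory V] [IsLocallyPresentable.{w} V]
  [∀ A : V, PreservesColimitsOfSize.{w, w} (tensorLeft A)]
  [∀ A : V, PreservesColimitsOfSize.{w, w} (tensorRight A)]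

section

variable (κ : Cardinal.{w}) [Fact κ.IsRegular] [IsCardinalLocallyPresentable V κ]

theorem isCardinalLocallyPresentable_arr : IsCardinalLocallyPresentable (vMat.{w} V).Arr κ :=
  (ofPairs V).asEquivalence.isCardinalLocallyPresentable κ

theorem isCardinalLocallyPresentable_fixedSrc (X : Type w) :
    IsCardinalLocallyPresentable (FixedSrc V X) κ :=
  (ofRows V X).asEquivalence.isCardinalLocallyPresentable κ

theorem isCardinalLocallyPresentable_fixedTgt (Y : Type w) :
    IsCardinalLocallyPresentable (FixedTgt V Y) κ :=
  (ofColumns V Y).asEquivalence.isCardinalLocallyPresentable κ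

end

/-- Any `κ` for which `V` is locally `κ`-presentable works, whatever `M` is, because the functor
preserves all small colimits. -/
theorem isAccessibleFunctor_precomp {X Y : Type w} (M : Mat V X Y) :
    IsAccessibleFunctor.{w} (precomp M) := by
  obtain ⟨κ, _, _⟩ := IsLocallyPresentable.exists_cardinal.{w} V
  have := isCardinalLocallyPresentable_fixedSrc (V := V) κ X
  have := isCardinalLocallyPresentable_fixedSrc (V := V) κ Y
  have := preservesColimits_precomp M
  exact ⟨κ, inferInstance, inferInstance, inferInstance, ⟨fun _ _ _ => inferInstance⟩⟩

theorem isAccessibleFunctor_postcomp {X Y : Type w} (M : Mat V X Y) :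
    IsAccessibleFunctor.{w} (postcomp M) := by
  obtain ⟨κ, _, _⟩ := IsLocallyPresentable.exists_cardinal.{w} V
  have := isCardinalLocallyPresentable_fixedTgt (V := V) κ X
  have := isCardinalLocallyPresentable_fixedTgt (V := V) κ Y
  have := preservesColimits_postcomp M
  exact ⟨κ, inferInstance, inferInstance, inferInstance, ⟨fun _ _ _ => inferInstance⟩⟩

end LocallyPresentable

end VMat

end

theorem proposition3p18 {V : Type u} [Category.{w} V] [MonoidalCategory V]
    [IsLocallyPresentable.{w} V]
    [∀ A : V, PreservesColimitsOfSize.{w, w} (tensorLeft A)]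
    [∀ A : V, PreservesColimitsOfSize.{w, w} (tensorRight A)] :
    PseudoDoubleCategory.IsLocallyPresentable.{w} (vMat.{w} V) := by
  obtain ⟨κ, _, _⟩ := IsLocallyPresentable.exists_cardinal.{w} V
  exact ⟨κ, inferInstance,
    { fibrant := VMat.isFibrant_vMat
      -- Sets are locally `κ`-presentable for every regular `κ`, so only `V` constrains the choice
      -- of `κ`.
      obj := inferInstanceAs (IsCardinalLocallyPresentable (Type w) κ)
      arr := VMat.isCardinalLocallyPresentable_arr κ
      src_cocontinuous := VMat.preservesColimits_src
      src_isRightAdjoint := VMat.isRightAdjoint_src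
      tgt_cocontinuous := VMat.preservesColimits_tgt
      tgt_isRightAdjoint := VMat.isRightAdjoint_tgt
      precomp_accessible := fun M => VMat.isAccessibleFunctor_precomp M
      postcomp_accessible := fun M => VMat.isAccessibleFunctor_postcomp M }⟩
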